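/- Let $\omega$ and $\Omega$ be the first infinite and the first uncountable ordinal, and give spaces of ordinals the order topology. For a $C^*$-algebra $A$ let $\mathrm{Prim}(A)$ be the set of its primitive ideals (kernels of irreducible representations) with the hull-kernel topology. Write $P\approx Q$ if $f(P)=f(Q)$ for all bounded continuous $f:\mathrm{Prim}(A)\to\mathbb R$. Let $q_A(P)$ be the intersection of all primitive ideals equivalent to $P$, and let $\mathrm{Glimm}(A)=q_A(\mathrm{Prim}(A))$. On $\mathrm{Glimm}(A)$ let $\tau_q$ be the quotient topology of $q_A$, and let $\tau_{cr}$ be the weakest topology that makes continuous all $g:\mathrm{Glimm}(A)\to\mathbb R$ for which $g\circ q_A$ is bounded and continuous. Let $Y=([0,\Omega]\times[0,\omega])\setminus\{(\Omega,\omega)\}$, $S=\{\Omega\}\times[0,\omega)$ and $T=[0,\Omega)\times\{\omega\}$. Let $X=Y\cup\{y\}$ with $y\notin Y$, with the topology for which $Y$ is embedded homeomorphically, $\{y\}$ is open, and $\overline{\{y\}}=S\cup\{y\}$. Let $H$ be an infinite dimensional separable complex Hilbert space, $\mathcal L(H)$ the algebra of bounded operators and $\mathcal K(H)$ the ideal of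 compact operators. Then $H$ carries a sequence of mutually orthogonal projections with infinite dimensional ranges, and $X$ is a locally compact $T_0$-space. Let $(p_n)_{n\ge 0}$ be any such sequence. Put $B=C_0(Y)$, $D=C_0(S)$, $\rho:D\to\mathcal L(H)$, $\rho(f)=\sum_{n\ge 0} f(\Omega,n)p_n$, and $E=\rho(D)+\mathcal K(H)$. Let $\pi_1:B\to D$ be the restriction map, $\pi_2:E\to D$ the quotient map $\rho(d)+k\mapsto d$, and $$A=\{(b,e)\in B\oplus E \mid \pi_1(b)=\pi_2(e)\}.$$ Then $A$ is a $C^*$-algebra and there is a homeomorphism $\varphi:X\to\mathrm{Prim}(A)$ with $\varphi(x)=\{(b,e)\in A\mid b(x)=0\}$ for $x\in Y$ and $\varphi(y)=\{(b,e)\in A\mid e=0\}$, such that the following hold. 1. For $x,x'\in X$, $q_A(\varphi(x))=q_A(\varphi(x'))$ if and only if $x=x'$ or $x,x'\in S\cup\{y\}$. 2. The subset $K=q_A(\varphi(T\cup\{y\}))$ of $\mathrm{Glimm}(A)$ is $\tau_{cr}$-compact but not $\tau_q$-compact. 3. There are no $a\in A$ and $\alpha>0$ such that $K\subset\{G\in\mathrm{Glimm}(A)\mid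 \|a+G\|\ge\alpha\}$. -/

import Mathlib

namespace GlimmSpace

open Set Filter Topology
open scoped Ordinal ZeroAtInfty CStarAlgebra

section Prim

universe u

/-- A nonzero `*`-representation on a Hilbert space that is topologically irreducible: the only
closed invariant subspaces are `0` and the whole space. -/
structure IsIrreducibleRep {A : Type*} [NonUnitalCStarAlgebra A]
    {E : Type*} [NormedAddCommGroup E] [InnerProductSpace ℂ E] [CompleteSpace E]
    (π : A →⋆ₙₐ[ℂ] (E →L[ℂ] E)) : Prop where
  nonzero : ∃ a, π a ≠ 0
  irreducible : ∀ V : Submodule ℂ E, IsClosed (V : Set E) →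
    (∀ a, ∀ v ∈ V, π a v ∈ V) → V = ⊥ ∨ V = ⊤

/-- A primitive ideal is the kernel of an irreducible representation. (An irreducible
representation is cyclic, so a Hilbert space in the universe of `A` is no restriction.) -/
def IsPrimitiveIdeal {A : Type u} [NonUnitalCStarAlgebra A] (P : TwoSidedIdeal A) : Prop :=
  ∃ (E : Type u) (_ : NormedAddCommGroup E) (_ : InnerProductSpace ℂ E) (_ : CompleteSpace E)
    (π : A →⋆ₙₐ[ℂ] (E →L[ℂ] E)), IsIrreducibleRep π ∧ P = TwoSidedIdeal.ker π

/-- The set `Prim(A)` of primitive ideals of `A`. -/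
def Prim (A : Type u) [NonUnitalCStarAlgebra A] : Type u :=
  {P : TwoSidedIdeal A // IsPrimitiveIdeal P}

variable {A : Type u} [NonUnitalCStarAlgebra A]

/-- The underlying ideal of a point of `Prim(A)`. -/
def Prim.ideal (P : Prim A) : TwoSidedIdeal A := P.1

/-- The hull of an ideal: the primitive ideals that contain it. -/
def hull (I : TwoSidedIdeal A) : Set (Prim A) := {P | I ≤ P.ideal}

/-- Primitive ideals are prime; this is what makes the hulls the closed sets of a topology. -/
theorem IsPrimitiveIdeal.prime {P : TwoSidedIdeal A} (hP : IsPrimitiveIdeal P)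
    {a b : A} (h : ∀ x, a * x * b ∈ P) : a ∈ P ∨ b ∈ P := by
  obtain ⟨E, _, _, _, π, hπ, rfl⟩ := hP
  simp only [TwoSidedIdeal.mem_ker] at h ⊢
  by_contra! hab
  obtain ⟨ha, hb⟩ := hab
  let V : Submodule ℂ E := ⨅ x, LinearMap.ker (π (a * x)).toLinearMap
  have hmem : ∀ v, v ∈ V ↔ ∀ x, π (a * x) v = 0 := fun v => by simp [V]
  have hVc : IsClosed (V : Set E) := by
    have : (V : Set E) = ⋂ x, {v | π (a * x) v = 0} := by
      ext v; simp only [SetLike.mem_coe, hmem, mem_iInter, mem_ofPred_eq]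
    rw [this]
    exact isClosed_iInter fun x => isClosed_eq (π (a * x)).continuous continuous_const
  rcases hπ.irreducible V hVc (fun c v hv => by
      rw [hmem] at hv ⊢
      intro x
      have := hv (x * c)
      rwa [← mul_assoc, map_mul] at this) with hV | hV
  · apply hb
    ext v
    have : π b v ∈ V := by
      rw [hmem]; intro x
      have := DFunLike.congr_fun (h x) v
      rwa [map_mul] at this
    rw [hV] at this
    simpa using this
  · let W : Submodule ℂ E := ⨅ x, LinearMap.ker (π x).toLinearMap
    have hW : ∀ v, v ∈ W ↔ ∀ x, π x v = 0 := fun v => by simp [W]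
    have hWc : IsClosed (W : Set E) := by
      have : (W : Set E) = ⋂ x, {v | π x v = 0} := by
        ext v; simp only [SetLike.mem_coe, hW, mem_iInter, mem_ofPred_eq]
      rw [this]
      exact isClosed_iInter fun x => isClosed_eq (π x).continuous continuous_const
    rcases hπ.irreducible W hWc (fun c v hv => by
      rw [hW] at hv ⊢
      intro x
      rw [← mul_apply_eq_comp, ← map_mul]; exact hv _) with h0 | h0
    · apply ha
      have h1 : π (star a) = 0 := by
        ext v
        have : π (star a) v ∈ W := by
          rw [hW]; intro x
          have h2 : π (a * star x) = 0 := by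
            ext w
            exact (hmem w).1 (hV ▸ Submodule.mem_top) _
          have h3 : π (x * star a) = 0 := by
            have : x * star a = star (a * star x) := by simp
            rw [this, map_star, h2, star_zero]
          rw [map_mul] at h3
          exact DFunLike.congr_fun h3 v
        rw [h0] at this
        simpa using this
      rw [map_star] at h1
      simpa using h1
    · obtain ⟨c, hc⟩ := hπ.nonzero
      apply hc
      ext v
      exact (hW v).1 (h0 ▸ Submodule.mem_top) c

/-- The hull-kernel topology: the closed sets are exactly the hulls of ideals. -/
instance : TopologicalSpace (Prim A) :=
  TopologicalSpace.ofClosed {F | ∃ I : TwoSidedIdeal A, F = hull I}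
    ⟨⊤, by
      ext P
      simp only [mem_empty_iff_false, false_iff]
      intro h
      obtain ⟨E, _, _, _, π, hπ, hP⟩ := P.2
      obtain ⟨a, ha⟩ := hπ.nonzero
      have : a ∈ P.1 := h trivial
      rw [hP, TwoSidedIdeal.mem_ker] at this
      exact ha this⟩
    (fun S hS => ⟨⨆ I ∈ {I : TwoSidedIdeal A | hull I ∈ S}, I, by
      ext P
      simp only [hull, mem_sInter, mem_ofPred_eq, iSup_le_iff]
      refine ⟨fun h I hI => h _ hI, fun h F hF => ?_⟩
      obtain ⟨I, rfl⟩ := hS hF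
      exact h I hF⟩)
    (by
      rintro _ ⟨I, rfl⟩ _ ⟨J, rfl⟩
      refine ⟨I ⊓ J, ?_⟩
      ext P
      simp only [hull, mem_union, mem_ofPred_eq]
      refine ⟨fun h => h.elim inf_le_left.trans inf_le_right.trans, fun h => ?_⟩
      by_contra! hc
      obtain ⟨a, ha, haP⟩ := SetLike.not_le_iff_exists.1 hc.1
      obtain ⟨b, hb, hbP⟩ := SetLike.not_le_iff_exists.1 hc.2
      rcases P.2.prime (a := a) (b := b) (fun x => h ((TwoSidedIdeal.mem_inf _).2
        ⟨I.mul_mem_right _ _ (I.mul_mem_right _ _ ha), J.mul_mem_left _ _ hb⟩)) with h | h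
      exacts [haP h, hbP h])

theorem isClosed_prim_iff {F : Set (Prim A)} :
    IsClosed F ↔ ∃ I : TwoSidedIdeal A, F = hull I := by
  rw [← isOpen_compl_iff]
  change Fᶜᶜ ∈ {F | ∃ I : TwoSidedIdeal A, F = hull I} ↔ _
  rw [compl_compl]; rfl

/-- `P ≈ Q` if every bounded continuous real function on `Prim(A)` takes the same value at `P`
and `Q`. -/
def GlimmRel (P Q : Prim A) : Prop :=
  ∀ f : BoundedContinuousFunction (Prim A) ℝ, f P = f Q

/-- The kernel (intersection) of the equivalence class of `P`. -/
def glimmIdeal (P : Prim A) : TwoSidedIdeal A :=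
  sInf {I | ∃ Q : Prim A, GlimmRel P Q ∧ I = Q.ideal}

variable (A) in
/-- `Glimm(A)`: the set of the kernels of the equivalence classes of `≈`. -/
def Glimm : Type u := {G : TwoSidedIdeal A // ∃ P : Prim A, G = glimmIdeal P}

/-- The underlying ideal of a point of `Glimm(A)`. -/
def Glimm.ideal (G : Glimm A) : TwoSidedIdeal A := G.1

/-- The quotient map `q_A : Prim(A) → Glimm(A)`. -/
def glimmMap (P : Prim A) : Glimm A := ⟨glimmIdeal P, P, rfl⟩

variable (A) in
/-- `τ_q`: the quotient topology. -/
abbrev tauQ : TopologicalSpace (Glimm A) := TopologicalSpace.coinduced glimmMap inferInstance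

variable (A) in
/-- `τ_cr`: the weakest topology that makes continuous all the functions `g` on `Glimm(A)` that
arise by dropping a bounded continuous real function `f` on `Prim(A)`, i.e. `g ∘ q_A = f`. -/
abbrev tauCR : TopologicalSpace (Glimm A) :=
  ⨅ g : {g : Glimm A → ℝ //
      ∃ f : BoundedContinuousFunction (Prim A) ℝ, ∀ P, g (glimmMap P) = f P},
    TopologicalSpace.induced g.1 inferInstance

/-- The norm `‖a + G‖` of the class of `a` in the quotient of `A` by the ideal `G`. -/
noncomputable def quotientNorm (a : A) (G : TwoSidedIdeal A) : ℝ := ⨅ g : G, ‖a + g‖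

end Prim

section Plank

/-- `Y = ([0,Ω] × [0,ω]) \ {(Ω,ω)}`, where `Ω` is the first uncountable ordinal, with the subspace
topology of the product of the order topologies. -/
abbrev Plank : Type 1 :=
  {x : Iic (ω_ 1 : Ordinal.{0}) × Iic (ω : Ordinal.{0}) // x ≠ (⊤, ⊤)}

/-- `S = {Ω} × [0,ω)`. -/
def plankS : Set Plank := {x | x.1.1 = ⊤}

/-- `T = [0,Ω) × {ω}`. -/
def plankT : Set Plank := {x | x.1.2 = ⊤}

/-- The point `(Ω,n)` of `S`. -/
noncomputable def sPoint (n : ℕ) : plankS :=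
  ⟨⟨(⊤, ⟨(n : Ordinal.{0}), (Ordinal.natCast_lt_omega0 n).le⟩), fun h =>
    (Ordinal.natCast_lt_omega0 n).ne (congrArg Subtype.val (Prod.mk.inj h).2)⟩, rfl⟩

theorem sPoint_surjective : Function.Surjective sPoint := by
  rintro ⟨⟨⟨a, b⟩, hne⟩, ha⟩
  change a = ⊤ at ha
  subst ha
  have hb : (b : Ordinal) < ω := lt_of_le_of_ne b.2 fun h => hne (by
    congr 1
    exact Subtype.ext h)
  obtain ⟨n, hn⟩ := Ordinal.lt_omega0.1 hb
  refine ⟨n, Subtype.ext (Subtype.ext (Prod.ext rfl (Subtype.ext hn.symm)))⟩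

theorem sPoint_injective : Function.Injective sPoint := by
  intro m n h
  have : ((m : Ordinal.{0})) = n :=
    congrArg (fun s : plankS => ((s.1.1.2 : Iic (ω : Ordinal.{0})) : Ordinal.{0})) h
  exact_mod_cast this

theorem isClosed_plankS : IsClosed plankS :=
  isClosed_eq (continuous_fst.comp continuous_subtype_val) continuous_const

instance : DiscreteTopology plankS := by
  refine discreteTopology_iff_isOpen_singleton.2 fun s => ?_
  obtain ⟨n, rfl⟩ := sPoint_surjective s
  let g : plankS → Ordinal.{0} := fun s => ((s.1.1.2 : Iic (ω : Ordinal.{0})) : Ordinal.{0})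
  have hg : Continuous g :=
    continuous_subtype_val.comp (continuous_snd.comp
      (continuous_subtype_val.comp continuous_subtype_val))
  have hs : ({sPoint n} : Set plankS) = g ⁻¹' Iio (Order.succ (n : Ordinal)) ∩
      ⋂ m ∈ Finset.range n, {sPoint m}ᶜ := by
    ext s
    obtain ⟨k, rfl⟩ := sPoint_surjective s
    have : g (sPoint k) = k := rfl
    simp only [mem_singleton_iff, sPoint_injective.eq_iff, mem_inter_iff, mem_preimage, this,
      mem_Iio, Order.lt_succ_iff, Nat.cast_le, Finset.mem_range, mem_iInter, mem_compl_iff]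
    constructor
    · rintro rfl; exact ⟨le_rfl, fun i hi => hi.ne'⟩
    · rintro ⟨h1, h2⟩
      by_contra h
      exact h2 k (lt_of_le_of_ne h1 h) rfl
  rw [hs]
  exact (isOpen_Iio.preimage hg).inter
    (isOpen_biInter_finset fun m _ => isOpen_compl_singleton)

/-- The set `X = Y ∪ {y}`, with `extra` the additional point `y`. -/
inductive SpaceX : Type 1
  | emb (x : Plank) : SpaceX
  | extra : SpaceX

/-- The topology of `X` for which `Y` is embedded homeomorphically, `{y}` is open and the closure
of `{y}` is `S ∪ {y}` (see the three lemmas below). -/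
instance : TopologicalSpace SpaceX where
  IsOpen U := IsOpen (SpaceX.emb ⁻¹' U) ∧ ((∃ s ∈ plankS, SpaceX.emb s ∈ U) → SpaceX.extra ∈ U)
  isOpen_univ := ⟨isOpen_univ, fun _ => trivial⟩
  isOpen_inter U V hU hV := ⟨hU.1.inter hV.1, fun ⟨s, hs, hsU, hsV⟩ =>
    ⟨hU.2 ⟨s, hs, hsU⟩, hV.2 ⟨s, hs, hsV⟩⟩⟩
  isOpen_sUnion C hC := ⟨by
    rw [preimage_sUnion]; exact isOpen_biUnion fun U hU => (hC U hU).1,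
    fun ⟨s, hs, U, hU, hsU⟩ => ⟨U, hU, (hC U hU).2 ⟨s, hs, hsU⟩⟩⟩

theorem SpaceX.isOpen_iff {U : Set SpaceX} : IsOpen U ↔
    IsOpen (SpaceX.emb ⁻¹' U) ∧ ((∃ s ∈ plankS, SpaceX.emb s ∈ U) → SpaceX.extra ∈ U) := Iff.rfl

theorem SpaceX.isOpen_extra : IsOpen {SpaceX.extra} := by
  refine ⟨?_, fun _ => rfl⟩
  convert isOpen_empty (X := Plank)
  ext x
  simp

theorem SpaceX.closure_extra :
    closure {SpaceX.extra} = insert SpaceX.extra (SpaceX.emb '' plankS) := by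
  apply Subset.antisymm
  · refine closure_minimal (by simp) ?_
    rw [← isOpen_compl_iff]
    refine ⟨?_, ?_⟩
    · convert isClosed_plankS.isOpen_compl
      ext x
      simp
    · rintro ⟨s, hs, h⟩
      exact (h (Or.inr ⟨s, hs, rfl⟩)).elim
  · rintro x (rfl | ⟨s, hs, rfl⟩)
    · exact subset_closure rfl
    · refine mem_closure_iff.2 fun U hU hsU => ⟨_, hU.2 ⟨s, hs, hsU⟩, rfl⟩

theorem SpaceX.isEmbedding_emb : IsEmbedding SpaceX.emb := by
  refine ⟨⟨le_antisymm ?_ ?_⟩, fun _ _ h => SpaceX.emb.inj h⟩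
  · exact continuous_iff_le_induced.1 ⟨fun U hU => hU.1⟩
  · intro V hV
    refine isOpen_induced_iff.2 ⟨insert SpaceX.extra (SpaceX.emb '' V),
      ⟨?_, fun _ => Or.inl rfl⟩, ?_⟩ <;>
    · have : SpaceX.emb ⁻¹' insert SpaceX.extra (SpaceX.emb '' V) = V := by
        ext x
        simp
      first | exact this | (rw [this]; exact hV)

end Plank

section Algebra

/-- The restriction map `π₁ : B = C₀(Y) → D = C₀(S)`. -/
noncomputable def restrictS : C₀(Plank, ℂ) →⋆ₙₐ[ℂ] C₀(plankS, ℂ) where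
  toFun f := f.comp ⟨⟨Subtype.val, continuous_subtype_val⟩,
    isClosed_plankS.isClosedEmbedding_subtypeVal.tendsto_cocompact⟩
  map_smul' _ _ := rfl
  map_zero' := rfl
  map_add' _ _ := rfl
  map_mul' _ _ := rfl
  map_star' _ := rfl

theorem restrictS_apply (f : C₀(Plank, ℂ)) (s : plankS) : restrictS f s = f s := rfl

variable {H : Type*} [NormedAddCommGroup H] [InnerProductSpace ℂ H] [CompleteSpace H]

variable (H) in
/-- A sequence of mutually orthogonal projections on `H` with infinite dimensional ranges. -/
structure ProjSeq where
  proj : ℕ → H →L[ℂ] H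
  isStarProjection : ∀ n, IsStarProjection (proj n)
  orthogonal : ∀ m n, m ≠ n → proj m * proj n = 0
  infinite : ∀ n, ¬ FiniteDimensional ℂ (LinearMap.range (proj n).toLinearMap)

namespace ProjSeq

variable (p : ProjSeq H)

theorem inner_proj {m n : ℕ} (h : m ≠ n) (x y : H) :
    inner ℂ (p.proj m x) (p.proj n y) = 0 := by
  rw [← ContinuousLinearMap.adjoint_inner_right, ← ContinuousLinearMap.star_eq_adjoint,
    (p.isStarProjection m).isSelfAdjoint.star_eq, ← mul_apply_eq_comp,
    p.orthogonal m n h]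
  simp

theorem norm_sq_sum (s : Finset ℕ) (c : ℕ → ℂ) (x : H) :
    ‖(∑ n ∈ s, c n • p.proj n) x‖ ^ 2 = ∑ n ∈ s, ‖c n‖ ^ 2 * ‖p.proj n x‖ ^ 2 := by
  classical
  induction s using Finset.induction_on with
  | empty => simp
  | insert a s ha ih =>
    rw [Finset.sum_insert ha, Finset.sum_insert ha, ← ih, add_apply,
      sq, sq ‖(∑ n ∈ s, c n • p.proj n) x‖,
      norm_add_sq_eq_norm_sq_add_norm_sq_of_inner_eq_zero (𝕜 := ℂ)]
    · rw [smul_apply, norm_smul]; ring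
    · rw [sum_apply, inner_sum]
      refine Finset.sum_eq_zero fun n hn => ?_
      rw [smul_apply, smul_apply, inner_smul_left, inner_smul_right,
        p.inner_proj (by rintro rfl; exact ha hn)]
      simp

theorem sum_norm_sq_le (s : Finset ℕ) (x : H) : ∑ n ∈ s, ‖p.proj n x‖ ^ 2 ≤ ‖x‖ ^ 2 := by
  have h1 : ‖(∑ n ∈ s, p.proj n) x‖ ^ 2 = ∑ n ∈ s, ‖p.proj n x‖ ^ 2 := by
    simpa using p.norm_sq_sum s (fun _ => 1) x
  have h2 : ∑ n ∈ s, ‖p.proj n x‖ ^ 2 = (inner ℂ ((∑ n ∈ s, p.proj n) x) x).re := by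
    rw [sum_apply, sum_inner, Complex.re_sum]
    refine Finset.sum_congr rfl fun n _ => ?_
    rw [← inner_self_eq_norm_sq (𝕜 := ℂ), ← ContinuousLinearMap.adjoint_inner_left,
      ← ContinuousLinearMap.star_eq_adjoint,
      (p.isStarProjection n).isSelfAdjoint.star_eq, ← mul_apply_eq_comp,
      (p.isStarProjection n).isIdempotentElem.eq]
    rfl
  have h3 : ‖(∑ n ∈ s, p.proj n) x‖ ^ 2 ≤ ‖(∑ n ∈ s, p.proj n) x‖ * ‖x‖ := by
    rw [h1, h2]
    exact (Complex.re_le_norm _).trans (norm_inner_le_norm _ _)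
  rw [← h1]
  have h4 : ‖(∑ n ∈ s, p.proj n) x‖ ≤ ‖x‖ := by
    by_contra! h
    nlinarith [norm_nonneg x]
  gcongr

theorem norm_sum_le (s : Finset ℕ) (c : ℕ → ℂ) {C : ℝ} (hC : 0 ≤ C) (h : ∀ n ∈ s, ‖c n‖ ≤ C) :
    ‖∑ n ∈ s, c n • p.proj n‖ ≤ C := by
  refine ContinuousLinearMap.opNorm_le_bound _ hC fun x => ?_
  refine le_of_sq_le_sq ?_ (by positivity)
  rw [p.norm_sq_sum, mul_pow]
  calc ∑ n ∈ s, ‖c n‖ ^ 2 * ‖p.proj n x‖ ^ 2 ≤ ∑ n ∈ s, C ^ 2 * ‖p.proj n x‖ ^ 2 := by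
        gcongr with n hn; exact h n hn
    _ ≤ C ^ 2 * ‖x‖ ^ 2 := by
        rw [← Finset.mul_sum]; gcongr; exact p.sum_norm_sq_le s x

theorem summable (f : C₀(plankS, ℂ)) : Summable fun n => f (sPoint n) • p.proj n := by
  rw [summable_iff_vanishing_norm]
  intro ε hε
  have h0 : Tendsto (fun n => f (sPoint n)) cofinite (𝓝 0) := by
    have := f.zero_at_infty'
    rw [cocompact_eq_cofinite] at this
    exact this.comp sPoint_injective.tendsto_cofinite
  have hfin : {n | ¬ ‖f (sPoint n)‖ < ε / 2}.Finite := by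
    have := (tendsto_zero_iff_norm_tendsto_zero.1 h0).eventually (gt_mem_nhds (half_pos hε))
    exact this
  refine ⟨hfin.toFinset, fun t ht => ?_⟩
  refine (p.norm_sum_le t _ (half_pos hε).le fun n hn => ?_).trans_lt (half_lt_self hε)
  by_contra h
  exact Finset.disjoint_left.1 ht hn (hfin.mem_toFinset.2 (fun h' => h h'.le))

/-- The embedding `ρ : D → L(H)`, `ρ(f) = ∑ₙ f(Ω,n) pₙ` (norm convergent, see `summable`). -/
noncomputable def rho : C₀(plankS, ℂ) →⋆ₙₐ[ℂ] (H →L[ℂ] H) where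
  toFun f := ∑' n, f (sPoint n) • p.proj n
  map_smul' c f := by
    simp only [ZeroAtInftyContinuousMap.smul_apply, smul_assoc, MonoidHom.id_apply]
    exact tsum_const_smul'' c
  map_zero' := by simp
  map_add' f g := by
    simp only [ZeroAtInftyContinuousMap.add_apply, add_smul]
    exact (p.summable f).tsum_add (p.summable g)
  map_mul' f g := by
    rw [← (p.summable g).tsum_mul_left]
    refine tsum_congr fun n => ?_
    rw [← (p.summable f).tsum_mul_right, tsum_eq_single n]
    · rw [smul_mul_smul_comm, (p.isStarProjection n).isIdempotentElem.eq]; rfl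
    · intro m hm
      rw [smul_mul_smul_comm, p.orthogonal m n hm, smul_zero]
  map_star' f := by
    rw [tsum_star]
    refine tsum_congr fun n => ?_
    rw [star_smul, (p.isStarProjection n).isSelfAdjoint.star_eq]; rfl

theorem rho_apply (f : C₀(plankS, ℂ)) : p.rho f = ∑' n, f (sPoint n) • p.proj n := rfl

theorem proj_mul_rho (n : ℕ) (f : C₀(plankS, ℂ)) :
    p.proj n * p.rho f = f (sPoint n) • p.proj n := by
  rw [rho_apply, ← (p.summable f).tsum_mul_left, tsum_eq_single n]
  · rw [mul_smul_comm, (p.isStarProjection n).isIdempotentElem.eq]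
  · intro m hm
    rw [mul_smul_comm, p.orthogonal n m hm.symm, smul_zero]

theorem not_isCompactOperator_proj (n : ℕ) : ¬ IsCompactOperator (p.proj n) := by
  intro h
  refine p.infinite n ?_
  set V := LinearMap.range (p.proj n).toLinearMap
  have hid : ∀ v ∈ V, p.proj n v = v := by
    rintro _ ⟨x, rfl⟩
    change p.proj n (p.proj n x) = p.proj n x
    rw [← mul_apply_eq_comp, (p.isStarProjection n).isIdempotentElem.eq]
  have hc : IsClosed (V : Set H) := by
    have : (V : Set H) = {v | p.proj n v = v} := by
      ext v
      exact ⟨hid v, fun h => ⟨v, h⟩⟩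
    rw [this]
    exact isClosed_eq (p.proj n).continuous continuous_id
  have h2 := IsCompactOperator.restrict (f := (p.proj n).toLinearMap) h (V := V)
    (fun v hv => by change p.proj n v ∈ V; rw [hid v hv]; exact hv) hc
  refine FiniteDimensional.of_isCompactOperator_id (𝕜 := ℂ) (E := V) ?_
  have h3 : (id : V → V) = (p.proj n).toLinearMap.restrict
      (fun v hv => by change p.proj n v ∈ V; rw [hid v hv]; exact hv) :=
    funext fun v => Subtype.ext (hid v v.2).symm
  rw [h3]
  exact h2

theorem norm_apply_le {f : C₀(plankS, ℂ)} {k : H →L[ℂ] H} (hk : IsCompactOperator k) (n : ℕ) :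
    ‖f (sPoint n)‖ ≤ ‖p.rho f + k‖ := by
  by_contra! hlt
  set c := f (sPoint n)
  set P := p.proj n
  have hPP : P * P = P := (p.isStarProjection n).isIdempotentElem.eq
  have hP1 : ‖P‖ ≤ 1 := (p.isStarProjection n).norm_le
  have hc : c ≠ 0 := fun h => by
    rw [h, norm_zero] at hlt
    exact (norm_nonneg _).not_gt hlt
  set M : H →L[ℂ] H := c⁻¹ • (P * (p.rho f + k) * P) with hM
  have hM1 : ‖M‖ < 1 := by
    have : ‖P * (p.rho f + k) * P‖ ≤ ‖p.rho f + k‖ := by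
      calc _ ≤ ‖P‖ * ‖p.rho f + k‖ * ‖P‖ := (norm_mul_le _ _).trans (by gcongr; exact norm_mul_le _ _)
        _ ≤ 1 * ‖p.rho f + k‖ * 1 := by gcongr
        _ = _ := by ring
    rw [hM, norm_smul, norm_inv, inv_mul_lt_iff₀ (norm_pos_iff.2 hc), mul_one]
    exact this.trans_lt hlt
  have hMP : c • M = c • P + P * k * P := by
    rw [hM, smul_inv_smul₀ hc, mul_add, add_mul, p.proj_mul_rho, smul_mul_assoc]
    change c • (P * P) + _ = _
    rw [hPP]
  have hMM : M * P = M := by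
    rw [hM, smul_mul_assoc, mul_assoc _ P P, hPP]
  let u := Units.oneSub M hM1
  have hu : (u : H →L[ℂ] H) * P = -(c⁻¹ • (P * k * P)) := by
    have h1 : (u : H →L[ℂ] H) = 1 - M := rfl
    have h2 : P * k * P = c • M - c • P := by rw [hMP]; abel
    rw [h1, sub_mul, one_mul, hMM, h2, smul_sub, inv_smul_smul₀ hc, inv_smul_smul₀ hc]
    abel
  have hP : P = ((↑u⁻¹ : H →L[ℂ] H) * -(c⁻¹ • P)) * k * P := by
    have : P = (↑u⁻¹ : H →L[ℂ] H) * ((u : H →L[ℂ] H) * P) := by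
      rw [← mul_assoc, Units.inv_mul, one_mul]
    conv_lhs => rw [this, hu]
    simp only [mul_neg, neg_mul, mul_smul_comm, smul_mul_assoc, mul_assoc]
  apply p.not_isCompactOperator_proj n
  change IsCompactOperator P
  rw [hP]
  exact (hk.clm_comp ((↑u⁻¹ : H →L[ℂ] H) * -(c⁻¹ • P))).comp_clm P

theorem norm_le_norm_rho_add {f : C₀(plankS, ℂ)} {k : H →L[ℂ] H} (hk : IsCompactOperator k) :
    ‖f‖ ≤ ‖p.rho f + k‖ := by
  rw [← ZeroAtInftyContinuousMap.norm_toBCF_eq_norm,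
    BoundedContinuousFunction.norm_le (norm_nonneg _)]
  intro s
  obtain ⟨n, rfl⟩ := sPoint_surjective s
  exact p.norm_apply_le hk n

end ProjSeq

theorem isCompactOperator_star {T : H →L[ℂ] H} (hT : IsCompactOperator T) :
    IsCompactOperator (star T : H →L[ℂ] H) := by
  have hTT : IsCompactOperator (T * star T : H →L[ℂ] H) := hT.comp_clm (star T)
  refine (isCompactOperator_iff_isCompact_closure_image_closedBall (𝕜₁ := ℂ)
    ((star T : H →L[ℂ] H).toLinearMap) one_pos).2 ?_
  have htb : TotallyBounded ((T * star T : H →L[ℂ] H) '' Metric.closedBall 0 1) :=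
    (hTT.isCompact_closure_image_closedBall (f := (T * star T : H →L[ℂ] H).toLinearMap)
      1).totallyBounded.subset subset_closure
  refine isCompact_iff_totallyBounded_isComplete.2 ⟨TotallyBounded.closure ?_, isClosed_closure.isComplete⟩
  rw [Metric.totallyBounded_iff]
  intro ε hε
  obtain ⟨t, ht, htf, hcov⟩ := Metric.finite_approx_of_totallyBounded htb (ε ^ 2 / 2) (by positivity)
  obtain ⟨s', hs', hs'f, rfl⟩ : ∃ s' ⊆ Metric.closedBall (0 : H) 1, s'.Finite ∧
      (T * star T : H →L[ℂ] H) '' s' = t :=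
    by
    obtain ⟨s, h1, h2, h3⟩ := exists_subset_image_finite_and.1 ⟨t, ht, htf, rfl⟩
    exact ⟨s, h1, h2, h3.symm⟩
  refine ⟨(star T : H →L[ℂ] H) '' s', hs'f.image _, ?_⟩
  rintro _ ⟨x, hx, rfl⟩
  have := hcov ⟨x, hx, rfl⟩
  simp only [mem_iUnion, mem_image, exists_prop, exists_exists_and_eq_and, Metric.mem_ball,
    dist_eq_norm] at this ⊢
  obtain ⟨y, hy, hxy⟩ := this
  refine ⟨y, hy, ?_⟩
  change ‖(star T : H →L[ℂ] H) x - (star T : H →L[ℂ] H) y‖ < ε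
  rw [← map_sub] at hxy ⊢
  have hn : ‖x - y‖ ≤ 2 := by
    have h1 : ‖x‖ ≤ 1 := by simpa using hx
    have h2 : ‖y‖ ≤ 1 := by simpa using hs' hy
    linarith [norm_sub_le x y]
  refine lt_of_pow_lt_pow_left₀ 2 hε.le ?_
  rw [← inner_self_eq_norm_sq (𝕜 := ℂ), ContinuousLinearMap.star_eq_adjoint,
    ContinuousLinearMap.adjoint_inner_left, ← ContinuousLinearMap.star_eq_adjoint,
    ← mul_apply_eq_comp]
  calc _ ≤ ‖x - y‖ * ‖(T * star T : H →L[ℂ] H) (x - y)‖ :=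
        (Complex.re_le_norm _).trans (norm_inner_le_norm _ _)
    _ ≤ 2 * ‖(T * star T : H →L[ℂ] H) (x - y)‖ := by gcongr
    _ < ε ^ 2 := by linarith

namespace ProjSeq

variable (p : ProjSeq H)

/-- `E = ρ(D) + K(H)`, where `K(H)` is the ideal of compact operators. -/
noncomputable def algE : NonUnitalStarSubalgebra ℂ (H →L[ℂ] H) where
  carrier := {e | ∃ (d : C₀(plankS, ℂ)) (k : H →L[ℂ] H), IsCompactOperator k ∧ e = p.rho d + k}
  add_mem' := by
    rintro _ _ ⟨d, k, hk, rfl⟩ ⟨d', k', hk', rfl⟩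
    exact ⟨d + d', k + k', hk.add hk', by rw [map_add]; abel⟩
  zero_mem' := ⟨0, 0, isCompactOperator_zero, by simp⟩
  mul_mem' := by
    rintro _ _ ⟨d, k, hk, rfl⟩ ⟨d', k', hk', rfl⟩
    refine ⟨d * d', p.rho d * k' + k * (p.rho d' + k'),
      (hk'.clm_comp (p.rho d)).add (hk.comp_clm (p.rho d' + k')), ?_⟩
    rw [map_mul]; noncomm_ring
  smul_mem' := by
    rintro c _ ⟨d, k, hk, rfl⟩
    exact ⟨c • d, c • k, hk.smul c, by rw [map_smul, smul_add]⟩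
  star_mem' := by
    rintro _ ⟨d, k, hk, rfl⟩
    exact ⟨star d, star k, isCompactOperator_star hk, by rw [map_star, star_add]⟩

theorem exists_decomp (e : p.algE) : ∃ d : C₀(plankS, ℂ), IsCompactOperator (e.1 - p.rho d) := by
  obtain ⟨d, k, hk, h⟩ := e.2
  exact ⟨d, by rw [h]; simpa using hk⟩

/-- The `d ∈ D`, unique by `quotFun_eq`, for which `e - ρ(d)` is compact. -/
noncomputable def quotFun (e : p.algE) : C₀(plankS, ℂ) := (p.exists_decomp e).choose

theorem quotFun_spec (e : p.algE) : IsCompactOperator (e.1 - p.rho (p.quotFun e)) :=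
  (p.exists_decomp e).choose_spec

theorem quotFun_eq {e : p.algE} {d : C₀(plankS, ℂ)} (h : IsCompactOperator (e.1 - p.rho d)) :
    p.quotFun e = d := by
  have h1 := h.sub (p.quotFun_spec e)
  have h2 := p.norm_le_norm_rho_add (f := p.quotFun e - d)
    (k := -((e.1 - p.rho d) - (e.1 - p.rho (p.quotFun e)))) h1.neg
  rw [map_sub] at h2
  have h3 : p.rho (p.quotFun e) - p.rho d +
      -((e.1 - p.rho d) - (e.1 - p.rho (p.quotFun e))) = 0 := by abel
  rw [h3, norm_zero] at h2
  exact sub_eq_zero.1 (norm_le_zero_iff.1 h2)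

/-- The natural quotient map `π₂ : E → D`, `ρ(d) + k ↦ d` (its kernel is `K(H)`). -/
noncomputable def quotMap : p.algE →⋆ₙₐ[ℂ] C₀(plankS, ℂ) where
  toFun := p.quotFun
  map_smul' c e := p.quotFun_eq (by
    have := (p.quotFun_spec e).smul c
    rwa [← FunLike.coe_smul, smul_sub, ← map_smul] at this)
  map_zero' := p.quotFun_eq (by simpa using isCompactOperator_zero)
  map_add' e e' := p.quotFun_eq (by
    have := (p.quotFun_spec e).add (p.quotFun_spec e')
    rwa [← FunLike.coe_add, sub_add_sub_comm, ← map_add] at this)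
  map_mul' e e' := p.quotFun_eq (by
    have h1 : IsCompactOperator (p.rho (p.quotFun e) * (e'.1 - p.rho (p.quotFun e')) +
        (e.1 - p.rho (p.quotFun e)) * e'.1 : H →L[ℂ] H) :=
      ((p.quotFun_spec e').clm_comp (p.rho (p.quotFun e))).add
        ((p.quotFun_spec e).comp_clm e'.1)
    have h2 : (e * e').1 - p.rho (p.quotFun e * p.quotFun e') =
        p.rho (p.quotFun e) * (e'.1 - p.rho (p.quotFun e')) +
          (e.1 - p.rho (p.quotFun e)) * e'.1 := by
      rw [map_mul]
      change e.1 * e'.1 - _ = _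
      noncomm_ring
    rwa [h2])
  map_star' e := p.quotFun_eq (by
    have := isCompactOperator_star (p.quotFun_spec e)
    rwa [star_sub, ← map_star] at this)

theorem quotMap_eq_iff {e : p.algE} {d : C₀(plankS, ℂ)} :
    p.quotMap e = d ↔ IsCompactOperator (e.1 - p.rho d) :=
  ⟨fun h => h ▸ p.quotFun_spec e, p.quotFun_eq⟩

instance isClosed_algE : IsClosed (p.algE : Set (H →L[ℂ] H)) := by
  have hb : ∀ e : p.algE, ‖p.quotMap e‖ ≤ ‖e‖ := fun e => by
    have := p.norm_le_norm_rho_add (f := p.quotFun e) (p.quotFun_spec e)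
    rwa [add_sub_cancel] at this
  have hcont : UniformContinuous p.quotMap :=
    (AddMonoidHomClass.lipschitz_of_bound p.quotMap 1 (by simpa using hb)).uniformContinuous
  refine IsComplete.isClosed ?_
  rw [← completeSpace_coe_iff_isComplete]
  refine Metric.complete_of_cauchySeq_tendsto fun u hu => ?_
  obtain ⟨d, hd⟩ := cauchySeq_tendsto_of_complete (hcont.comp_cauchySeq hu)
  obtain ⟨e, he⟩ := cauchySeq_tendsto_of_complete
    (uniformContinuous_subtype_val.comp_cauchySeq hu)
  have hk : IsCompactOperator (e - p.rho d) := by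
    refine isCompactOperator_of_tendsto (F := fun n => (u n).1 - p.rho (p.quotMap (u n)))
      (l := atTop) ?_ (Eventually.of_forall fun n => p.quotFun_spec (u n))
    exact he.sub (((map_continuous p.rho).tendsto d).comp hd)
  exact ⟨⟨e, d, _, hk, by abel⟩, tendsto_subtype_rng.2 he⟩

/-- The pullback `A = {(b,e) ∈ B ⊕ E | π₁(b) = π₂(e)}`. -/
noncomputable def algA : NonUnitalStarSubalgebra ℂ (C₀(Plank, ℂ) × p.algE) :=
  NonUnitalStarAlgHom.equalizer
    (restrictS.comp (NonUnitalStarAlgHom.fst ℂ C₀(Plank, ℂ) p.algE))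
    (p.quotMap.comp (NonUnitalStarAlgHom.snd ℂ C₀(Plank, ℂ) p.algE))

theorem mem_algA {x : C₀(Plank, ℂ) × p.algE} :
    x ∈ p.algA ↔ restrictS x.1 = p.quotMap x.2 := Iff.rfl

instance isClosed_algA : IsClosed (p.algA : Set (C₀(Plank, ℂ) × p.algE)) :=
  isClosed_eq ((map_continuous restrictS).comp continuous_fst)
    ((map_continuous p.quotMap).comp continuous_snd)

/-- The subset `K = T ∪ {z}` of `Glimm(A)`, where `Prim(A)` is identified with `X` by `φ`: the image
of `T ∪ {y}` under `q_A` (and `z` is the image of `y`). -/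
def setK (p : ProjSeq H) (φ : SpaceX ≃ₜ Prim p.algA) : Set (Glimm p.algA) :=
  (fun x => glimmMap (φ x)) '' (SpaceX.emb '' plankT ∪ {SpaceX.extra})

end ProjSeq

end Algebra

end GlimmSpace

/-!
A continuous real function on `X` is constant on `S ∪ {y}`, the closure of `y`, and all other pairs
of points are separated, so under `Prim(A) ≅ X` the map `q_A` only collapses `S ∪ {y}`.

A continuous function on `Y` that equals `c` on `S` is constant near `Ω` on each row `[0,Ω] × {n}`;
since `Ω` is not a countable supremum it equals `c` at `(β,ω)` for all `β` near `Ω`. Hence in `τ_cr`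
the set `K` is a continuous image of `[0,Ω]`, with `Ω` sent to the class of `y`. In `τ_q` it is not
compact: the function with value `β` at `(β,ω)` and `0` off `T` is upper semicontinuous on `X` and
constant on the fibres of `q_A`, but has no maximum on `T ∪ {y}`. At the Glimm ideal of `t ∈ T` the
norm of `(b,e)` is at most `|b(t)|`, and `|b| ≥ α` holds only on a compact subset of `Y`, whereas
`T` is closed and not compact.

As for `Prim(A) ≅ X`: modulo the ideal `0 ⊕ K(H)` the algebra `A` is `C₀(Y)`, whose closed prime
ideals are the points of `Y`. A primitive ideal not containing `0 ⊕ K(H)` contains no `(b,e)` with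
`e ≠ 0`, since multiplying by rank-one operators on both sides would produce all of `K(H)` from it,
and it contains every `(b,0)`, since `(b,0)` annihilates `0 ⊕ K(H)`.
-/

namespace GlimmSpace

open Set Filter Topology
open scoped Ordinal ZeroAtInfty CStarAlgebra BoundedContinuousFunction

section Topology

variable {X Z : Type*} [TopologicalSpace X] [TopologicalSpace Z]

theorem eventually_eq_of_continuousAt [T1Space Z] [FirstCountableTopology Z] {f : X → Z} {x : X}
    [CountableInterFilter (𝓝 x)] (hf : ContinuousAt f x) : ∀ᶠ z in 𝓝 x, f z = f x := by
  obtain ⟨S, hSo, hSc, hS⟩ := IsGδ.singleton (f x)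
  have hmem : f ⁻¹' ⋂₀ S ∈ 𝓝 x := by
    rw [preimage_sInter]
    refine (countable_bInter_mem hSc).2 fun U hU => hf ((hSo U hU).mem_nhds ?_)
    exact sInter_subset_of_mem hU (hS ▸ mem_singleton (f x))
  rwa [← hS] at hmem

theorem exists_zeroAtInfty_bump {𝕜 : Type*} [RCLike 𝕜] [T2Space X] [LocallyCompactSpace X]
    {U : Set X} (hU : IsOpen U) {x : X} (hx : x ∈ U) :
    ∃ f : C₀(X, 𝕜), f x = 1 ∧ (∀ z ∉ U, f z = 0) ∧ ‖f‖ ≤ 1 := by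
  obtain ⟨f, hfx, hfU, hfc, hf01⟩ := exists_continuous_one_zero_of_isCompact
    (isCompact_singleton (x := x)) hU.isClosed_compl
    (disjoint_left.2 fun z hz hz' => hz' (by rwa [mem_singleton_iff.1 hz]))
  refine ⟨⟨⟨fun z => (f z : 𝕜), by fun_prop⟩, (hfc.comp_left RCLike.ofReal_zero).is_zero_at_infty⟩,
    ?_, fun z hz => ?_, ?_⟩
  · simp [hfx rfl]
  · simp [hfU hz]
  · rw [← ZeroAtInftyContinuousMap.norm_toBCF_eq_norm,
      BoundedContinuousFunction.norm_le zero_le_one]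
    intro z
    simpa [abs_of_nonneg (hf01 z).1] using (hf01 z).2

end Topology

section Ordinal

instance compactSpace_Iic {α : Type*} [Preorder α] [OrderBot α] [TopologicalSpace α]
    [CompactIccSpace α] (a : α) : CompactSpace (Iic a) :=
  isCompact_iff_compactSpace.1 (by rw [← Icc_bot]; exact isCompact_Icc)

theorem isSuccLimit_top_Iic {α : Type*} [Preorder α] {a : α} (ha : Order.IsSuccLimit a) :
    Order.IsSuccLimit (⊤ : Iic a) where
  not_isMin h := ha.not_isMin fun b hb => h (b := ⟨b, hb⟩) hb
  isSuccPrelimit b hb := ha.isSuccPrelimit b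
    ⟨hb.1, fun c hbc hca => hb.2 (c := ⟨c, hca.le⟩) hbc hca⟩

instance countableInterFilter_nhds_top_omega_one :
    CountableInterFilter (𝓝 (⊤ : Iic (ω_ 1 : Ordinal.{0}))) := by
  refine ⟨fun S hSc hS => ?_⟩
  have := hSc.to_subtype
  choose β hβ hβS using fun N : S => exists_Ioc_subset_of_mem_nhds (hS N N.2)
    (isSuccLimit_top_Iic (Cardinal.isSuccLimit_omega 1)).nonempty_Iio
  have hsup : ⨆ N, (β N : Ordinal) < ω_ 1 := Ordinal.iSup_lt_omega_one hβ
  filter_upwards [Ioi_mem_nhds (show (⟨_, hsup.le⟩ : Iic (ω_ 1)) < ⊤ from hsup)] with γ hγ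
  refine mem_sInter.2 fun N hN => hβS ⟨N, hN⟩ ⟨lt_of_le_of_lt ?_ hγ, le_top⟩
  exact le_ciSup (f := fun N => (β N : Ordinal)) Ordinal.bddAbove_of_small ⟨N, hN⟩

end Ordinal

section Plank

instance locallyCompactSpace_plank : LocallyCompactSpace Plank :=
  (isOpen_compl_singleton (x := ((⊤, ⊤) : Iic (ω_ 1 : Ordinal.{0}) × Iic (ω : Ordinal.{0}))
    )).isOpenEmbedding_subtypeVal.locallyCompactSpace

theorem isClosed_plankT : IsClosed plankT :=
  isClosed_eq (continuous_snd.comp continuous_subtype_val) continuous_const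

/-- The point `(β,ω)` of `T`. -/
def tPoint (β : Iic (ω_ 1 : Ordinal.{0})) (hβ : β ≠ ⊤) : Plank :=
  ⟨(β, ⊤), fun h => hβ (Prod.mk.inj h).1⟩

theorem fst_ne_top_of_mem_plankT {x : Plank} (hx : x ∈ plankT) : x.1.1 ≠ ⊤ :=
  fun h => x.2 (Prod.ext h hx)

theorem tPoint_fst {x : Plank} (hx : x ∈ plankT) :
    tPoint x.1.1 (fst_ne_top_of_mem_plankT hx) = x :=
  Subtype.ext (Prod.ext rfl hx.symm)

theorem not_isCompact_plankT : ¬ IsCompact plankT := by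
  intro hT
  have hlim : Order.IsSuccLimit (⊤ : Iic (ω_ 1 : Ordinal.{0})) :=
    isSuccLimit_top_Iic (Cardinal.isSuccLimit_omega 1)
  obtain ⟨β₀, hβ₀⟩ := hlim.nonempty_Iio
  obtain ⟨x, hx, hmax⟩ := hT.exists_isMaxOn ⟨tPoint β₀ hβ₀.ne, rfl⟩
    (continuous_fst.comp continuous_subtype_val).continuousOn
  obtain ⟨γ, hγ, hxγ⟩ := hlim.lt_iff_exists_lt.1 (fst_ne_top_of_mem_plankT hx).lt_top
  exact (hmax (a := tPoint γ hγ.ne) rfl).not_gt hxγ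

/-- Along each row `[0,Ω] × {n}` the function is constant near `Ω`, and countably many
neighbourhoods of `Ω` in `[0,Ω]` have a common one. -/
theorem eventually_tPoint_eq_of_plankS_eq {Z : Type*} [TopologicalSpace Z] [T1Space Z]
    [FirstCountableTopology Z] {f : Plank → Z} (hf : Continuous f) {c : Z}
    (hc : ∀ s ∈ plankS, f s = c) : ∀ᶠ β in 𝓝 ⊤, ∀ hβ : β ≠ ⊤, f (tPoint β hβ) = c := by
  have : Countable plankS := sPoint_surjective.countable
  have hrow : ∀ s : plankS, ∀ᶠ β in 𝓝 ⊤,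
      f ⟨(β, s.1.1.2), fun h => s.1.2 (Prod.ext s.2 (Prod.mk.inj h).2)⟩ = c := by
    intro s
    have hcont : Continuous fun β : Iic (ω_ 1 : Ordinal.{0}) =>
        f ⟨(β, s.1.1.2), fun h => s.1.2 (Prod.ext s.2 (Prod.mk.inj h).2)⟩ :=
      hf.comp (Continuous.subtype_mk (by fun_prop) _)
    filter_upwards [eventually_eq_of_continuousAt (hcont.continuousAt (x := ⊤))] with β hβ
    exact hβ.trans (hc _ rfl)
  filter_upwards [eventually_countable_forall.2 hrow] with β hβrow hβ
  let column (k : Iic (ω : Ordinal.{0})) : Plank := ⟨(β, k), fun h => hβ (Prod.mk.inj h).1⟩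
  have hclosed : IsClosed {k | f (column k) = c} :=
    (isClosed_singleton (x := c)).preimage (hf.comp (Continuous.subtype_mk (by fun_prop) _))
  have hlim := isSuccLimit_top_Iic Ordinal.isSuccLimit_omega0
  refine closure_minimal (fun k hk => ?_) hclosed (hlim.isLUB_Iio.mem_closure hlim.nonempty_Iio)
  exact hβrow ⟨⟨(⊤, k), fun h => hk.ne (Prod.mk.inj h).2⟩, rfl⟩

end Plank

namespace SpaceX

theorem isOpen_image_emb_union {V : Set Plank} {U : Set SpaceX} (hV : IsOpen V) (hU : IsOpen U)
    (h : V ⊆ emb ⁻¹' U) : IsOpen (emb '' V ∪ U ∩ {extra}) := by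
  have hextra : emb ⁻¹' {extra} = ∅ := by ext; simp
  refine ⟨by simpa [preimage_image_eq _ isEmbedding_emb.injective, hextra] using hV, ?_⟩
  rintro ⟨s, hs, ⟨z, hz, hzs⟩ | ⟨-, hsU⟩⟩
  · exact Or.inr ⟨hU.2 ⟨s, hs, h (emb.inj hzs ▸ hz)⟩, rfl⟩
  · cases hsU

instance locallyCompactSpace : LocallyCompactSpace SpaceX := by
  refine ⟨fun x N hN => ?_⟩
  obtain ⟨U, hUN, hU, hxU⟩ := mem_nhds_iff.1 hN
  rcases x with x | _
  · obtain ⟨C, hC, hCU, hCc⟩ := local_compact_nhds (hU.1.mem_nhds hxU)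
    refine ⟨emb '' C ∪ U ∩ {extra}, ?_, ?_, ?_⟩
    · refine mem_of_superset ((isOpen_image_emb_union isOpen_interior hU
        (interior_subset.trans hCU)).mem_nhds (Or.inl ⟨x, mem_interior_iff_mem_nhds.2 hC, rfl⟩)) ?_
      exact union_subset_union_left _ (image_mono interior_subset)
    · exact (union_subset (image_subset_iff.2 hCU) inter_subset_left).trans hUN
    · exact (hCc.image isEmbedding_emb.continuous).union
        ((finite_singleton extra).inter_of_right U).isCompact
  · exact ⟨{extra}, isOpen_extra.mem_nhds rfl, singleton_subset_iff.2 (hUN hxU),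
      isCompact_singleton⟩

instance t0Space : T0Space SpaceX := by
  refine ⟨fun x x' h => ?_⟩
  have hextra : ∀ z, Inseparable extra z → extra = z := fun z hz =>
    ((hz.mem_open_iff isOpen_extra).1 rfl).symm
  rcases x with x | _
  · rcases x' with x' | _
    · exact congrArg _ (isEmbedding_emb.isInducing.inseparable_iff.1 h).eq
    · exact (hextra _ h.symm).symm
  · exact hextra _ h

theorem extra_specializes_iff {x : SpaceX} : extra ⤳ x ↔ x ∈ emb '' plankS ∪ {extra} := by
  rw [specializes_iff_mem_closure, closure_extra, union_singleton]

open Classical in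
/-- The idempotent map `X → X` that sends `S ∪ {y}` to `y` and fixes the other points. Its fibres
are the classes of the points of `X` that no bounded continuous real function separates. -/
noncomputable def collapse (x : SpaceX) : SpaceX := if extra ⤳ x then extra else x

theorem collapse_specializes (x : SpaceX) : collapse x ⤳ x := by
  unfold collapse
  split_ifs with hx
  exacts [hx, specializes_rfl]

theorem collapse_eq_collapse_iff {x x' : SpaceX} : collapse x = collapse x' ↔
    x = x' ∨ (x ∈ emb '' plankS ∪ {extra} ∧ x' ∈ emb '' plankS ∪ {extra}) := by
  simp only [← extra_specializes_iff, collapse]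
  split_ifs with hx hx' hx'
  · simp [hx, hx']
  · simp only [hx', and_false, or_false]
    exact ⟨fun h => (hx' (h ▸ specializes_rfl)).elim, fun h => (hx' (h ▸ hx)).elim⟩
  · simp only [hx, false_and, or_false]
    exact ⟨fun h => (hx (h ▸ specializes_rfl)).elim, fun h => (hx (h ▸ hx')).elim⟩
  · simp [hx]

theorem exists_separating {x : SpaceX} (hx : ¬ extra ⤳ x) {x' : SpaceX} (h : x ≠ x') :
    ∃ f : SpaceX →ᵇ ℝ, f x ≠ f x' := by
  obtain ⟨z, rfl⟩ : ∃ z, x = emb z := by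
    rcases x with z | _
    exacts [⟨z, rfl⟩, (hx specializes_rfl).elim]
  obtain ⟨g, hgz, hg, -⟩ := exists_zeroAtInfty_bump (𝕜 := ℝ) (x := z)
    (U := (plankS ∪ emb ⁻¹' {x'})ᶜ)
    (isClosed_plankS.union ((finite_singleton x').preimage
      isEmbedding_emb.injective.injOn).isClosed).isOpen_compl
    (by
      rintro (hz | hz)
      exacts [hx (extra_specializes_iff.2 (Or.inl ⟨z, hz, rfl⟩)), h hz])
  let f : SpaceX → ℝ := SpaceX.rec g 0
  have hf : Continuous f := by
    refine ⟨fun V hV => ⟨hV.preimage (map_continuous g), ?_⟩⟩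
    rintro ⟨s, hs, hsV⟩
    have hgs : f (emb s) = 0 := hg s fun hsU => hsU (Or.inl hs)
    rwa [mem_preimage, hgs] at hsV
  refine ⟨.ofNormedAddCommGroup f hf ‖g.toBCF‖ ?_, ?_⟩
  · rintro (w | _)
    exacts [g.toBCF.norm_coe_le_norm w, norm_zero.trans_le (norm_nonneg _)]
  · have hfx' : f x' = 0 := by
      rcases x' with w | _
      exacts [hg w fun hw => hw (Or.inr rfl), rfl]
    change g z ≠ f x'
    rw [hgz, hfx']
    exact one_ne_zero

theorem forall_boundedContinuous_eq_iff {x x' : SpaceX} :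
    (∀ f : SpaceX →ᵇ ℝ, f x = f x') ↔ collapse x = collapse x' := by
  refine ⟨fun h => ?_, fun h f => ?_⟩
  · rw [collapse_eq_collapse_iff, ← extra_specializes_iff, ← extra_specializes_iff]
    by_contra! hne
    by_cases hx : extra ⤳ x
    · obtain ⟨f, hf⟩ := exists_separating (hne.2 hx) hne.1.symm
      exact hf (h f).symm
    · obtain ⟨f, hf⟩ := exists_separating hx hne.1
      exact hf (h f)
  · have hf (z : SpaceX) : f (collapse z) = f z :=
      ((collapse_specializes z).map f.continuous).eq
    rw [← hf, h, hf]

open Classical in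
/-- The parametrisation of `T ∪ {y}` by `[0,Ω]`: `β ↦ (β,ω)` for `β < Ω`, and `Ω ↦ y`. -/
noncomputable def edge (β : Iic (ω_ 1 : Ordinal.{0})) : SpaceX :=
  if hβ : β = ⊤ then extra else emb (tPoint β hβ)

theorem edge_of_ne_top {β : Iic (ω_ 1 : Ordinal.{0})} (hβ : β ≠ ⊤) :
    edge β = emb (tPoint β hβ) := dif_neg hβ

theorem range_edge : range edge = emb '' plankT ∪ {extra} := by
  apply Subset.antisymm
  · rintro _ ⟨β, rfl⟩
    by_cases hβ : β = ⊤
    · exact Or.inr (dif_pos hβ)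
    · exact Or.inl ⟨tPoint β hβ, rfl, (edge_of_ne_top hβ).symm⟩
  · rintro _ (⟨x, hx, rfl⟩ | rfl)
    · exact ⟨x.1.1, by rw [edge_of_ne_top (fst_ne_top_of_mem_plankT hx), tPoint_fst hx]⟩
    · exact ⟨⊤, dif_pos rfl⟩

theorem continuous_comp_edge {Z : Type*} [TopologicalSpace Z] [T1Space Z]
    [FirstCountableTopology Z] {f : SpaceX → Z} (hf : Continuous f) : Continuous (f ∘ edge) := by
  refine continuous_iff_continuousAt.2 fun β => ?_
  by_cases hβ : β = ⊤
  · subst hβ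
    have hS : ∀ s ∈ plankS, f (emb s) = f extra := fun s hs =>
      ((extra_specializes_iff.2 (Or.inl ⟨s, hs, rfl⟩)).map hf).eq.symm
    have hconst : f ∘ edge =ᶠ[𝓝 ⊤] fun _ => f extra := by
      filter_upwards [eventually_tPoint_eq_of_plankS_eq (hf.comp isEmbedding_emb.continuous) hS]
        with γ hγ
      by_cases h : γ = ⊤
      · simp [edge, h]
      · simpa [edge_of_ne_top h] using hγ h
    exact continuousAt_const.congr hconst.symm
  · refine ContinuousOn.continuousAt (s := {⊤}ᶜ) ?_ (isOpen_compl_singleton.mem_nhds hβ)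
    rw [continuousOn_iff_continuous_domRestrict]
    have htPoint : Continuous fun γ : ({⊤}ᶜ : Set (Iic (ω_ 1 : Ordinal.{0}))) =>
        tPoint γ γ.2 := Continuous.subtype_mk (by fun_prop) _
    refine (hf.comp (isEmbedding_emb.continuous.comp htPoint)).congr fun γ => ?_
    exact congrArg f (edge_of_ne_top γ.2).symm

open Classical in
/-- The first coordinate on `T`, extended by `0` to `X`. -/
noncomputable def height : SpaceX → Iic (ω_ 1 : Ordinal.{0})
  | emb x => if x ∈ plankT then x.1.1 else ⊥
  | extra => ⊥

theorem height_edge {β : Iic (ω_ 1 : Ordinal.{0})} (hβ : β ≠ ⊤) : height (edge β) = β := by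
  rw [edge_of_ne_top hβ]
  exact if_pos rfl

theorem height_of_extra_specializes {x : SpaceX} (hx : extra ⤳ x) : height x = ⊥ := by
  rcases extra_specializes_iff.1 hx with ⟨s, hs, rfl⟩ | rfl
  · exact if_neg fun hT => fst_ne_top_of_mem_plankT hT hs
  · rfl

theorem height_collapse (x : SpaceX) : height (collapse x) = height x := by
  unfold collapse
  split_ifs with hx
  exacts [(height_of_extra_specializes hx).symm, rfl]

theorem upperSemicontinuous_height : UpperSemicontinuous height := by
  refine upperSemicontinuous_iff_isOpen_preimage.2 fun β => ?_
  rcases eq_bot_or_bot_lt β with rfl | hβ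
  · simp
  · refine ⟨?_, fun _ => hβ⟩
    have hclosed : IsClosed (plankT ∩ {x : Plank | β ≤ x.1.1}) :=
      isClosed_plankT.inter (isClosed_Ici.preimage (continuous_fst.comp continuous_subtype_val))
    convert hclosed.isOpen_compl using 1
    ext x
    by_cases hx : x ∈ plankT <;> simp [height, hx, hβ]

theorem exists_height_lt_height_edge (x : SpaceX) : ∃ β, height x < height (edge β) := by
  have hlim : Order.IsSuccLimit (⊤ : Iic (ω_ 1 : Ordinal.{0})) :=
    isSuccLimit_top_Iic (Cardinal.isSuccLimit_omega 1)
  have hx : height x < ⊤ := by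
    unfold height
    split
    · split_ifs with hT
      exacts [(fst_ne_top_of_mem_plankT hT).lt_top, hlim.bot_lt]
    · exact hlim.bot_lt
  obtain ⟨β, hβ, hxβ⟩ := hlim.lt_iff_exists_lt.1 hx
  exact ⟨β, by rwa [height_edge hβ.ne]⟩

end SpaceX

section PrimitiveIdealSpace

variable {A : Type*} [NonUnitalCStarAlgebra A] {X : Type*} [TopologicalSpace X]

theorem Prim.ideal_injective : Function.Injective (Prim.ideal : Prim A → TwoSidedIdeal A) :=
  Subtype.val_injective

theorem mem_hull {I : TwoSidedIdeal A} {P : Prim A} : P ∈ hull I ↔ I ≤ P.ideal := Iff.rfl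

theorem Prim.specializes_iff {P Q : Prim A} : P ⤳ Q ↔ P.ideal ≤ Q.ideal := by
  rw [specializes_iff_forall_closed]
  refine ⟨fun h => h (hull P.ideal) (isClosed_prim_iff.2 ⟨_, rfl⟩) (mem_hull.2 le_rfl),
    fun h F hF hP => ?_⟩
  obtain ⟨I, rfl⟩ := isClosed_prim_iff.1 hF
  exact hP.trans h

theorem Prim.continuous_of_isClosed {f : X → Prim A}
    (hf : ∀ a, IsClosed {x | a ∈ (f x).ideal}) : Continuous f := by
  refine continuous_iff_isClosed.2 fun F hF => ?_
  obtain ⟨I, rfl⟩ := isClosed_prim_iff.1 hF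
  convert isClosed_biInter fun a (_ : a ∈ I) => hf a
  ext x
  simp [mem_hull, SetLike.le_def]

theorem Prim.isInducing_of_separating {f : X → Prim A}
    (hf : ∀ a, IsClosed {x | a ∈ (f x).ideal})
    (hsep : ∀ F : Set X, IsClosed F → ∀ x ∉ F,
      ∃ a, (∀ z ∈ F, a ∈ (f z).ideal) ∧ a ∉ (f x).ideal) : IsInducing f := by
  refine ⟨TopologicalSpace.ext_iff_isClosed.2 fun F => ?_⟩
  rw [isClosed_induced_iff]
  refine ⟨fun hF => ?_, ?_⟩
  · refine ⟨hull (sInf ((fun z => (f z).ideal) '' F)), isClosed_prim_iff.2 ⟨_, rfl⟩, ?_⟩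
    refine Subset.antisymm (fun x hx => ?_) fun x hx => mem_hull.2 (sInf_le ⟨x, hx, rfl⟩)
    by_contra hxF
    obtain ⟨a, haF, hax⟩ := hsep F hF x hxF
    refine hax (hx ((TwoSidedIdeal.mem_sInf _).2 ?_))
    rintro _ ⟨z, hz, rfl⟩
    exact haF z hz
  · rintro ⟨G, hG, rfl⟩
    exact hG.preimage (Prim.continuous_of_isClosed hf)

end PrimitiveIdealSpace

section Irreducible

universe v w

theorem IsPrimitiveIdeal.isClosed {A : Type*} [NonUnitalCStarAlgebra A] {P : TwoSidedIdeal A}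
    (hP : IsPrimitiveIdeal P) : IsClosed {a | a ∈ P} := by
  obtain ⟨E, _, _, _, π, -, rfl⟩ := hP
  exact isClosed_singleton.preimage (map_continuous π)

theorem IsPrimitiveIdeal.exists_notMem {A : Type*} [NonUnitalCStarAlgebra A] {P : TwoSidedIdeal A}
    (hP : IsPrimitiveIdeal P) : ∃ a, a ∉ P := by
  obtain ⟨E, _, _, _, π, hπ, rfl⟩ := hP
  simpa only [TwoSidedIdeal.mem_ker] using hπ.nonzero

theorem IsIrreducibleRep.conj {A : Type*} [NonUnitalCStarAlgebra A]
    {H K : Type*} [NormedAddCommGroup H] [InnerProductSpace ℂ H] [CompleteSpace H]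
    [NormedAddCommGroup K] [InnerProductSpace ℂ K] [CompleteSpace K]
    {π : A →⋆ₙₐ[ℂ] (H →L[ℂ] H)} (hπ : IsIrreducibleRep π) (U : H ≃ₗᵢ[ℂ] K) :
    IsIrreducibleRep ((U.conjStarAlgEquiv : (H →L[ℂ] H) →⋆ₙₐ[ℂ] (K →L[ℂ] K)).comp π) where
  nonzero := hπ.nonzero.imp fun a ha h =>
    ha ((map_eq_zero_iff U.conjStarAlgEquiv (EquivLike.injective _)).1 h)
  irreducible V hV hinv := by
    have hW := hπ.irreducible (V.comap U.toLinearEquiv.toLinearMap) (hV.preimage U.continuous)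
      fun a v hv => by simpa using hinv a _ hv
    refine hW.imp (fun h => ?_) fun h => ?_
    · exact Submodule.comap_injective_of_surjective U.surjective (by simpa using h)
    · exact Submodule.comap_injective_of_surjective U.surjective (by simpa using h)

/-- The Hilbert space `H` moved to a larger universe. -/
noncomputable def liftIsometry (H : Type v) [NormedAddCommGroup H] [InnerProductSpace ℂ H] :
    H ≃ₗᵢ[ℂ] PiLp 2 (fun _ : PUnit.{w + 1} => H) :=
  LinearIsometryEquiv.symm
    ⟨(PiLp.equivOfUnique 2 ℂ (fun _ : PUnit.{w + 1} => H)).toLinearEquiv, fun x => by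
      simp [PiLp.norm_eq_of_L2]⟩

theorem isPrimitiveIdeal_ker {A : Type max w v} [NonUnitalCStarAlgebra A]
    {H : Type v} [NormedAddCommGroup H] [InnerProductSpace ℂ H] [CompleteSpace H]
    {π : A →⋆ₙₐ[ℂ] (H →L[ℂ] H)} (hπ : IsIrreducibleRep π) :
    IsPrimitiveIdeal (TwoSidedIdeal.ker π) := by
  let U := liftIsometry.{v, max w v} H
  refine ⟨_, _, _, _, _, hπ.conj U, ?_⟩
  ext a
  simp only [TwoSidedIdeal.mem_ker]
  exact (map_eq_zero_iff U.conjStarAlgEquiv (EquivLike.injective _)).symm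

theorem isPrimitiveIdeal_ker_character {A : Type*} [NonUnitalCStarAlgebra A] (χ : A →⋆ₙₐ[ℂ] ℂ)
    (hχ : ∃ a, χ a ≠ 0) : IsPrimitiveIdeal (TwoSidedIdeal.ker χ) := by
  let ι : ℂ →⋆ₙₐ[ℂ] (ℂ →L[ℂ] ℂ) := StarAlgHom.ofId ℂ (ℂ →L[ℂ] ℂ)
  have hι : Function.Injective ι := FaithfulSMul.algebraMap_injective ℂ (ℂ →L[ℂ] ℂ)
  have hirr : IsIrreducibleRep (ι.comp χ) :=
    ⟨hχ.imp fun a ha h => ha ((map_eq_zero_iff ι hι).1 h), fun V _ _ => eq_bot_or_eq_top V⟩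
  convert isPrimitiveIdeal_ker hirr using 1
  ext a
  simp only [TwoSidedIdeal.mem_ker]
  exact (map_eq_zero_iff ι hι).symm

end Irreducible

section Glimm

variable {A : Type*} [NonUnitalCStarAlgebra A] {X : Type*} [TopologicalSpace X]

theorem glimmRel_homeomorph_iff (φ : X ≃ₜ Prim A) {x x' : X} :
    GlimmRel (φ x) (φ x') ↔ ∀ f : X →ᵇ ℝ, f x = f x' := by
  refine ⟨fun h f => ?_, fun h f => h (f.compContinuous ⟨φ, φ.continuous⟩)⟩
  simpa using h (f.compContinuous ⟨φ.symm, φ.symm.continuous⟩)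

theorem glimmIdeal_eq_of_le {P Q : Prim A} (hPQ : GlimmRel P Q)
    (hle : ∀ R, GlimmRel P R → Q.ideal ≤ R.ideal) : glimmIdeal P = Q.ideal :=
  le_antisymm (sInf_le ⟨Q, hPQ, rfl⟩) (le_sInf <| by rintro _ ⟨R, hR, rfl⟩; exact hle R hR)

theorem continuous_tauCR_glimmMap_comp {h : X → Prim A}
    (hh : ∀ f : Prim A →ᵇ ℝ, Continuous (f ∘ h)) :
    Continuous[_, tauCR A] (glimmMap ∘ h) := by
  refine continuous_iInf_rng.2 fun ⟨g, f, hgf⟩ => continuous_induced_rng.2 ?_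
  exact (hh f).congr fun x => (hgf (h x)).symm

theorem exists_isMaxOn_of_isCompact_tauQ {β : Type*} [LinearOrder β] {u : Prim A → β}
    (hu : UpperSemicontinuous u) (hfactor : ∀ P Q, glimmMap P = glimmMap Q → u P = u Q)
    {C : Set (Prim A)} (hC : @IsCompact _ (tauQ A) (glimmMap '' C)) (hne : C.Nonempty) :
    ∃ P ∈ C, IsMaxOn u C P := by
  have : Nonempty β := hne.to_type.map fun P => u P
  obtain ⟨g, rfl⟩ := (Function.factorsThrough_iff u).1 fun P Q => hfactor P Q
  let := tauQ A
  have hg : UpperSemicontinuous g := upperSemicontinuous_iff_isOpen_preimage.2 fun b =>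
    isOpen_coinduced.2 (upperSemicontinuous_iff_isOpen_preimage.1 hu b)
  obtain ⟨_, ⟨P, hP, rfl⟩, hmax⟩ :=
    (hg.upperSemicontinuousOn _).exists_isMaxOn (hne.image _) hC
  exact ⟨P, hP, fun Q hQ => hmax (mem_image_of_mem _ hQ)⟩

theorem quotientNorm_le_of_sub_mem {a c : A} {G : TwoSidedIdeal A} (h : c - a ∈ G) :
    quotientNorm a G ≤ ‖c‖ := by
  have hle : quotientNorm a G ≤ ‖a + (c - a)‖ :=
    ciInf_le ⟨0, by rintro _ ⟨_, rfl⟩; exact norm_nonneg _⟩ (⟨c - a, h⟩ : G)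
  rwa [add_sub_cancel] at hle

end Glimm

section GlimmSpaceX

open SpaceX

variable {A : Type*} [NonUnitalCStarAlgebra A] (φ : SpaceX ≃ₜ Prim A)

theorem glimmIdeal_homeomorph (x : SpaceX) : glimmIdeal (φ x) = (φ (collapse x)).ideal := by
  refine glimmIdeal_eq_of_le ((glimmRel_homeomorph_iff φ).2 fun f => ?_) fun R hR => ?_
  · exact ((collapse_specializes x).map f.continuous).eq.symm
  · obtain ⟨z, rfl⟩ := φ.surjective R
    rw [glimmRel_homeomorph_iff, forall_boundedContinuous_eq_iff] at hR
    rw [hR]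
    exact Prim.specializes_iff.1 ((collapse_specializes z).map φ.continuous)

theorem glimmMap_homeomorph_eq_iff {x x' : SpaceX} :
    glimmMap (φ x) = glimmMap (φ x') ↔ collapse x = collapse x' := by
  have hideal : glimmMap (φ x) = glimmMap (φ x') ↔ glimmIdeal (φ x) = glimmIdeal (φ x') :=
    Subtype.ext_iff
  rw [hideal, glimmIdeal_homeomorph, glimmIdeal_homeomorph, Prim.ideal_injective.eq_iff,
    φ.injective.eq_iff]

theorem isCompact_tauCR_image_edge :
    @IsCompact _ (tauCR A) ((fun x => glimmMap (φ x)) '' (emb '' plankT ∪ {extra})) := by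
  rw [← range_edge, ← range_comp]
  let := tauCR A
  exact isCompact_range (continuous_tauCR_glimmMap_comp (h := φ ∘ edge) fun f =>
    continuous_comp_edge (f.continuous.comp φ.continuous))

theorem not_isCompact_tauQ_image_edge :
    ¬ @IsCompact _ (tauQ A) ((fun x => glimmMap (φ x)) '' (emb '' plankT ∪ {extra})) := by
  intro hK
  rw [← range_edge, show (fun x => glimmMap (φ x)) = glimmMap ∘ φ from rfl, image_comp] at hK
  have hfactor (P Q : Prim A) (h : glimmMap P = glimmMap Q) :
      height (φ.symm P) = height (φ.symm Q) := by
    rw [← φ.apply_symm_apply P, ← φ.apply_symm_apply Q, glimmMap_homeomorph_eq_iff] at h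
    rw [← height_collapse, h, height_collapse]
  obtain ⟨_, ⟨x, -, rfl⟩, hmax⟩ := exists_isMaxOn_of_isCompact_tauQ
    (upperSemicontinuous_height.comp φ.symm.continuous) hfactor hK
    ((range_nonempty edge).image φ)
  obtain ⟨β, hβ⟩ := exists_height_lt_height_edge x
  have hle : height (edge β) ≤ height x := by
    simpa using hmax (mem_image_of_mem φ (mem_range_self β))
  exact hle.not_gt hβ

end GlimmSpaceX

section FunctionAlgebra

variable {X 𝕜 : Type*} [TopologicalSpace X] [RCLike 𝕜]

theorem isCompact_setOf_le_norm {E : Type*} [NormedAddCommGroup E] (f : C₀(X, E)) {ε : ℝ}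
    (hε : 0 < ε) : IsCompact {x | ε ≤ ‖f x‖} := by
  have hlt : ∀ᶠ x in cocompact X, ‖f x‖ < ε :=
    (tendsto_zero_iff_norm_tendsto_zero.1 f.zero_at_infty').eventually (gt_mem_nhds hε)
  obtain ⟨t, ht, hsub⟩ := mem_cocompact.1 hlt
  refine ht.of_isClosed_subset (isClosed_le continuous_const (map_continuous f).norm) fun x hx => ?_
  by_contra hxt
  exact (show ε ≤ ‖f x‖ from hx).not_gt (hsub hxt)

theorem norm_zeroAtInfty_le {E : Type*} [NormedAddCommGroup E] {f : C₀(X, E)} {C : ℝ}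
    (hC : 0 ≤ C) : ‖f‖ ≤ C ↔ ∀ x, ‖f x‖ ≤ C := by
  rw [← ZeroAtInftyContinuousMap.norm_toBCF_eq_norm, BoundedContinuousFunction.norm_le hC]
  rfl

theorem exists_nonneg_mem_of_isCompact (I : TwoSidedIdeal C₀(X, 𝕜)) {K : Set X} (hK : IsCompact K)
    (h : ∀ x ∈ K, ∃ g ∈ I, g x ≠ 0) :
    ∃ g ∈ I, (∀ x, g x = (‖g x‖ : 𝕜)) ∧ ∀ x ∈ K, g x ≠ 0 := by
  refine hK.induction_on (p := fun s => ∃ g ∈ I, (∀ x, g x = (‖g x‖ : 𝕜)) ∧ ∀ x ∈ s, g x ≠ 0)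
    ⟨0, I.zero_mem, by simp, by simp⟩ ?_ ?_ ?_
  · rintro s t hst ⟨g, hgI, hg, hgt⟩
    exact ⟨g, hgI, hg, fun x hx => hgt x (hst hx)⟩
  · rintro s t ⟨g, hgI, hg, hgs⟩ ⟨g', hgI', hg', hgt⟩
    have hsum (x : X) : (g + g') x = ((‖g x‖ + ‖g' x‖ : ℝ) : 𝕜) := by
      rw [RCLike.ofReal_add, ← hg, ← hg']
      rfl
    refine ⟨g + g', I.add_mem hgI hgI', fun x => ?_, fun x hx => ?_⟩
    · rw [hsum, RCLike.norm_of_nonneg (by positivity)]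
    · rw [hsum, RCLike.ofReal_ne_zero]
      rcases hx with hx | hx
      · exact (add_pos_of_pos_of_nonneg (norm_pos_iff.2 (hgs x hx)) (norm_nonneg _)).ne'
      · exact (add_pos_of_nonneg_of_pos (norm_nonneg _) (norm_pos_iff.2 (hgt x hx))).ne'
  · intro x hx
    obtain ⟨g, hgI, hgx⟩ := h x hx
    refine ⟨{z | g z ≠ 0}, mem_nhdsWithin_of_mem_nhds
      ((isOpen_ne_fun (map_continuous g) continuous_const).mem_nhds hgx), star g * g,
      I.mul_mem_left _ _ hgI, fun z => ?_, fun z hz => mul_ne_zero (star_ne_zero.2 hz) hz⟩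
    change star (g z) * g z = (‖star (g z) * g z‖ : 𝕜)
    rw [CStarRing.norm_star_mul_self, RCLike.star_def, RCLike.conj_mul, sq, RCLike.ofReal_mul]

/-- Take `h = r f / (1 + r g)` with `r` large, so that `f - g h = f / (1 + r g)`. -/
theorem exists_norm_sub_mul_le (f : C₀(X, 𝕜)) {g : C₀(X, 𝕜)} (hg : ∀ x, g x = (‖g x‖ : 𝕜))
    {ε : ℝ} (hε : 0 < ε) (hgf : ∀ x, ε ≤ ‖f x‖ → g x ≠ 0) :
    ∃ h : C₀(X, 𝕜), ‖f - g * h‖ ≤ ε := by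
  obtain ⟨c, hc, hcg⟩ := (isCompact_setOf_le_norm f hε).exists_forall_le'
    (map_continuous g).norm.continuousOn (a := 0) fun x hx => norm_pos_iff.2 (hgf x hx)
  obtain ⟨r, hr, hrc⟩ : ∃ r : ℝ, 0 ≤ r ∧ ‖f‖ ≤ ε * (r * c) :=
    ⟨‖f‖ / (ε * c), by positivity, by field_simp; rfl⟩
  have hden (x : X) : 1 ≤ 1 + r * ‖g x‖ := by
    have := mul_nonneg hr (norm_nonneg (g x))
    linarith
  have hden0 (x : X) : 0 < 1 + r * ‖g x‖ := one_pos.trans_le (hden x)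
  have hfactor : Continuous fun x => r / (1 + r * ‖g x‖) :=
    continuous_const.div (by fun_prop) fun x => (hden0 x).ne'
  let h : C₀(X, 𝕜) := ⟨⟨fun x => ((r / (1 + r * ‖g x‖) : ℝ) : 𝕜) * f x, by fun_prop⟩, by
    refine squeeze_zero_norm (a := fun x => r * ‖f x‖) (fun x => ?_) ?_
    · rw [norm_mul, RCLike.norm_of_nonneg (div_nonneg hr (hden0 x).le)]
      exact mul_le_mul_of_nonneg_right (div_le_self hr (hden x)) (norm_nonneg _)
    · simpa using (tendsto_zero_iff_norm_tendsto_zero.1 f.zero_at_infty').const_mul r⟩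
  have hsub (x : X) : (f - g * h) x = (((1 + r * ‖g x‖)⁻¹ : ℝ) : 𝕜) * f x := by
    have hscalar : 1 - ‖g x‖ * (r / (1 + r * ‖g x‖)) = (1 + r * ‖g x‖)⁻¹ := by
      field_simp [(hden0 x).ne']
      ring
    change f x - g x * (((r / (1 + r * ‖g x‖) : ℝ) : 𝕜) * f x) = _
    rw [← hscalar, hg x, RCLike.ofReal_sub, RCLike.ofReal_mul, RCLike.ofReal_one,
      RCLike.norm_ofReal, abs_norm]
    ring
  refine ⟨h, (norm_zeroAtInfty_le hε.le).2 fun x => ?_⟩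
  rw [hsub, norm_mul, RCLike.norm_of_nonneg (inv_nonneg.2 (hden0 x).le), inv_mul_le_iff₀ (hden0 x)]
  by_cases hx : ε ≤ ‖f x‖
  · calc ‖f x‖ ≤ ε * (r * c) := ((norm_zeroAtInfty_le (norm_nonneg f)).1 le_rfl x).trans hrc
      _ ≤ ε * (r * ‖g x‖) := by gcongr; exact hcg x hx
      _ ≤ (1 + r * ‖g x‖) * ε := by linarith
  · nlinarith [hden x]

theorem mem_of_forall_common_zero {I : TwoSidedIdeal C₀(X, 𝕜)} (hI : IsClosed {f | f ∈ I})
    {f : C₀(X, 𝕜)} (hf : ∀ x, (∀ g ∈ I, g x = 0) → f x = 0) : f ∈ I := by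
  refine Metric.mem_of_closed' hI |>.2 fun ε hε => ?_
  have hfree : ∀ x ∈ {x | ε / 2 ≤ ‖f x‖}, ∃ g ∈ I, g x ≠ 0 := by
    intro x hx
    by_contra! hzero
    have hfx : ε / 2 ≤ ‖f x‖ := hx
    rw [hf x hzero, norm_zero] at hfx
    linarith
  obtain ⟨g, hgI, hg, hgf⟩ :=
    exists_nonneg_mem_of_isCompact I (isCompact_setOf_le_norm f (half_pos hε)) hfree
  obtain ⟨h, hh⟩ := exists_norm_sub_mul_le f hg (half_pos hε) hgf
  exact ⟨g * h, I.mul_mem_right _ _ hgI, by rw [dist_eq_norm]; linarith⟩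

theorem exists_forall_mem_iff_apply_eq_zero [T2Space X] [LocallyCompactSpace X]
    {I : TwoSidedIdeal C₀(X, 𝕜)} (hI : IsClosed {f | f ∈ I}) (hproper : ∃ f, f ∉ I)
    (hprime : ∀ f g, f * g = 0 → f ∈ I ∨ g ∈ I) : ∃ x, ∀ f, f ∈ I ↔ f x = 0 := by
  obtain ⟨x, hx⟩ : ∃ x, ∀ g ∈ I, g x = 0 := by
    obtain ⟨f, hf⟩ := hproper
    by_contra! hno
    exact hf (mem_of_forall_common_zero hI fun x hx =>
      let ⟨g, hg, hgx⟩ := hno x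
      (hgx (hx g hg)).elim)
  refine ⟨x, fun f => ⟨hx f, fun hfx => mem_of_forall_common_zero hI fun z hz => ?_⟩⟩
  suffices z = x from this ▸ hfx
  by_contra hzx
  obtain ⟨U, V, hU, hV, hzU, hxV, hUV⟩ := t2_separation hzx
  obtain ⟨b, hbz, hbU, -⟩ := exists_zeroAtInfty_bump (𝕜 := 𝕜) hU hzU
  obtain ⟨b', hbx, hbV, -⟩ := exists_zeroAtInfty_bump (𝕜 := 𝕜) hV hxV
  have hmul : b * b' = 0 := by
    ext w
    by_cases hw : w ∈ U
    · simp [hbV w (disjoint_left.1 hUV hw)]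
    · simp [hbU w hw]
  rcases hprime b b' hmul with hb | hb'
  · exact one_ne_zero (hbz.symm.trans (hz b hb))
  · exact one_ne_zero (hbx.symm.trans (hx b' hb'))

end FunctionAlgebra

section Operators

open InnerProductSpace

variable {𝕜 H : Type*} [RCLike 𝕜] [NormedAddCommGroup H] [InnerProductSpace 𝕜 H]

theorem exists_orthonormal_nat [CompleteSpace H] (hH : ¬ FiniteDimensional 𝕜 H) :
    ∃ e : ℕ → H, Orthonormal 𝕜 e := by
  obtain ⟨w, b, -⟩ := exists_hilbertBasis 𝕜 H
  have : Infinite w := by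
    by_contra hw
    have : Finite w := not_infinite_iff_finite.1 hw
    have := Fintype.ofFinite w
    exact hH b.toOrthonormalBasis.toBasis.finiteDimensional_of_finite
  exact ⟨b ∘ Infinite.natEmbedding w, b.orthonormal.comp _ (Infinite.natEmbedding w).injective⟩

theorem not_finiteDimensional_of_orthonormal {ι : Type*} [Infinite ι] {e : ι → H}
    (he : Orthonormal 𝕜 e) {V : Submodule 𝕜 H} (hV : ∀ i, e i ∈ V) :
    ¬ FiniteDimensional 𝕜 V := fun _ =>
  have hli : LinearIndependent 𝕜 fun i => (⟨e i, hV i⟩ : V) :=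
    .of_comp V.subtype he.linearIndependent
  not_finite_iff_infinite.2 ‹_› hli.finite

theorem nonempty_projSeq {H : Type*} [NormedAddCommGroup H] [InnerProductSpace ℂ H]
    [CompleteSpace H] (hH : ¬ FiniteDimensional ℂ H) : Nonempty (ProjSeq H) := by
  obtain ⟨e, he⟩ := exists_orthonormal_nat hH
  let column (n : ℕ) : ℕ → H := fun k => e (Nat.pair n k)
  let V (n : ℕ) : Submodule ℂ H := (Submodule.span ℂ (range (column n)))ᗮᗮ
  have hmem (n k : ℕ) : column n k ∈ V n :=
    Submodule.le_orthogonal_orthogonal _ (Submodule.subset_span ⟨k, rfl⟩)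
  refine ⟨⟨fun n => (V n).starProjection, fun n => isStarProjection_starProjection,
    fun m n hmn => ?_, fun n => ?_⟩⟩
  · have hspan : Submodule.span ℂ (range (column m)) ⟂ Submodule.span ℂ (range (column n)) := by
      rw [Submodule.isOrtho_span]
      rintro _ ⟨k, rfl⟩ _ ⟨l, rfl⟩
      exact he.2 fun h => hmn (Nat.pair_eq_pair.1 h).1
    exact Submodule.IsOrtho.starProjection_comp_starProjection
      (Submodule.orthogonal_le (Submodule.orthogonal_le hspan))
  · rw [show LinearMap.range (V n).starProjection.toLinearMap = V n from
      Submodule.range_starProjection _]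
    exact not_finiteDimensional_of_orthonormal
      (he.comp (Nat.pair n) fun k l h => (Nat.pair_eq_pair.1 h).2) (hmem n)

theorem isCompactOperator_rankOne (x y : H) : IsCompactOperator (rankOne 𝕜 x y) := by
  rw [rankOne_def']
  exact (isCompactOperator_of_locallyCompactSpace_dom (innerSL 𝕜 y)).clm_comp
    (ContinuousLinearMap.toSpanSingleton 𝕜 x)

theorem eq_bot_or_top_of_rankOne_mem {V : Submodule 𝕜 H}
    (hV : ∀ x y : H, ∀ v ∈ V, rankOne 𝕜 x y v ∈ V) : V = ⊥ ∨ V = ⊤ := by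
  refine or_iff_not_imp_left.2 fun hbot => Submodule.eq_top_iff'.2 fun x => ?_
  obtain ⟨v, hv, hv0⟩ := V.ne_bot_iff.1 hbot
  have hx := V.smul_mem (inner 𝕜 v v)⁻¹ (hV x v v hv)
  rwa [rankOne_apply, inv_smul_smul₀ (inner_self_ne_zero.2 hv0)] at hx

theorem exists_finiteDimensional_norm_sub_starProjection_comp_le {k : H →L[𝕜] H}
    (hk : IsCompactOperator k) {ε : ℝ} (hε : 0 < ε) :
    ∃ (V : Submodule 𝕜 H) (_ : FiniteDimensional 𝕜 V), ‖k - V.starProjection ∘L k‖ ≤ ε := by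
  have hball : TotallyBounded (k '' Metric.closedBall 0 1) :=
    (hk.isCompact_closure_image_closedBall (f := k.toLinearMap)
      1).totallyBounded.subset subset_closure
  obtain ⟨t, -, htf, hcover⟩ := Metric.finite_approx_of_totallyBounded hball ε hε
  let V := Submodule.span 𝕜 t
  have : FiniteDimensional 𝕜 V := FiniteDimensional.span_of_finite 𝕜 htf
  refine ⟨V, this, ContinuousLinearMap.opNorm_le_of_unit_norm hε.le fun x hx => ?_⟩
  obtain ⟨y, hy, hxy⟩ := mem_iUnion₂.1 (hcover ⟨x, by simp [hx], rfl⟩)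
  calc ‖k x - V.starProjection (k x)‖ ≤ ‖k x - y‖ := by
        rw [Submodule.starProjection_minimal]
        exact ciInf_le ⟨0, by rintro _ ⟨_, rfl⟩; positivity⟩ (⟨y, Submodule.subset_span hy⟩ : V)
    _ ≤ ε := by rw [← dist_eq_norm]; exact (Metric.mem_ball.1 hxy).le

/-- The rank-one operator `z ↦ ⟪y, z⟫ x` as an element of the ideal of compact operators. -/
noncomputable def compactRankOne (x y : H) : compactOperator (RingHom.id 𝕜) H H :=
  ⟨rankOne 𝕜 x y, isCompactOperator_rankOne x y⟩

theorem eq_top_of_compactRankOne_mem [CompleteSpace H]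
    {M : AddSubgroup (compactOperator (RingHom.id 𝕜) H H)} (hM : IsClosed {k | k ∈ M})
    (hrank : ∀ x y : H, compactRankOne x y ∈ M) : M = ⊤ := by
  refine (AddSubgroup.eq_top_iff' M).2 fun k => (Metric.mem_of_closed' hM).2 fun ε hε => ?_
  obtain ⟨V, _, hV⟩ :=
    exists_finiteDimensional_norm_sub_starProjection_comp_le k.2 (half_pos hε)
  let e := stdOrthonormalBasis 𝕜 V
  have hsum : V.starProjection ∘L k.1 =
      ∑ i, rankOne 𝕜 (e i : H) (ContinuousLinearMap.adjoint k.1 (e i)) := by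
    simp only [e.starProjection_eq_sum_rankOne, ContinuousLinearMap.finsetSum_comp, rankOne_comp]
  refine ⟨∑ i, compactRankOne (e i : H) (ContinuousLinearMap.adjoint k.1 (e i)),
    sum_mem fun i _ => hrank _ _, ?_⟩
  rw [Subtype.dist_eq, dist_eq_norm, AddSubmonoidClass.coe_finsetSum]
  rw [hsum] at hV
  exact hV.trans_lt (half_lt_self hε)

end Operators

namespace ProjSeq

variable {H : Type*} [NormedAddCommGroup H] [InnerProductSpace ℂ H] [CompleteSpace H]
  {p : ProjSeq H}

theorem quotMap_eq_zero_iff {e : p.algE} :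
    p.quotMap e = 0 ↔ IsCompactOperator (e : H →L[ℂ] H) := by
  rw [quotMap_eq_iff, map_zero, sub_zero]

theorem algA_ext {a b : p.algA} (hfst : a.1.1 = b.1.1)
    (hsnd : (a.1.2 : H →L[ℂ] H) = b.1.2) : a = b :=
  Subtype.ext (Prod.ext hfst (Subtype.ext hsnd))

theorem restrictS_fst (a : p.algA) : restrictS a.1.1 = p.quotMap a.1.2 := p.mem_algA.1 a.2

theorem exists_ne_zero (p : ProjSeq H) : ∃ v : H, v ≠ 0 := by
  by_contra! h
  refine p.not_isCompactOperator_proj 0 ?_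
  rw [show p.proj 0 = 0 from ContinuousLinearMap.ext fun v => h _]
  exact isCompactOperator_zero

variable (p)

/-- The homomorphism `ρ`, with values in `E`. -/
noncomputable def rhoE : C₀(plankS, ℂ) →⋆ₙₐ[ℂ] p.algE :=
  NonUnitalStarAlgHom.codRestrict p.rho p.algE fun d => ⟨d, 0, isCompactOperator_zero, by simp⟩

theorem quotMap_rhoE (d : C₀(plankS, ℂ)) : p.quotMap (p.rhoE d) = d := by
  rw [quotMap_eq_iff, show (p.rhoE d : H →L[ℂ] H) = p.rho d from rfl, sub_self]
  exact isCompactOperator_zero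

/-- The splitting `b ↦ (b, ρ(π₁ b))` of the projection of `A` onto `B`. -/
noncomputable def ofB : C₀(Plank, ℂ) →⋆ₙₐ[ℂ] p.algA :=
  NonUnitalStarAlgHom.codRestrict
    ((NonUnitalStarAlgHom.id ℂ C₀(Plank, ℂ)).prod (p.rhoE.comp restrictS)) p.algA fun b =>
      p.mem_algA.2 (p.quotMap_rhoE (restrictS b)).symm

/-- The embedding `k ↦ (0, k)` of the compact operators into `A`. -/
noncomputable def ofK : compactOperator (RingHom.id ℂ) H H →+ p.algA where
  toFun k := ⟨(0, ⟨k.1, 0, k.1, k.2, by simp⟩), p.mem_algA.2 <|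
    (map_zero restrictS).trans (quotMap_eq_zero_iff.2 (show IsCompactOperator k.1 from k.2)).symm⟩
  map_zero' := rfl
  map_add' k k' := Subtype.ext (Prod.ext (add_zero _).symm rfl)

theorem continuous_ofK : Continuous p.ofK :=
  Continuous.subtype_mk (continuous_const.prodMk (Continuous.subtype_mk continuous_subtype_val _)) _

variable {p}

theorem exists_eq_ofB_add_ofK (a : p.algA) : ∃ k, a = p.ofB a.1.1 + p.ofK k := by
  have hcompact : IsCompactOperator ((a.1.2 - p.rhoE (restrictS a.1.1) : p.algE) : H →L[ℂ] H) := by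
    rw [← quotMap_eq_zero_iff, map_sub, quotMap_rhoE, restrictS_fst, sub_self]
  exact ⟨⟨_, hcompact⟩, algA_ext (add_zero _).symm (add_sub_cancel _ _).symm⟩

theorem forall_ofK_mem_of_compactRankOne {I : TwoSidedIdeal p.algA}
    (hI : IsClosed {a | a ∈ I}) (hrank : ∀ x y : H, p.ofK (compactRankOne x y) ∈ I)
    (k : compactOperator (RingHom.id ℂ) H H) : p.ofK k ∈ I := by
  have htop : (AddSubgroup.ofClass I).comap p.ofK = ⊤ :=
    eq_top_of_compactRankOne_mem (hI.preimage p.continuous_ofK) hrank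
  exact htop.ge (AddSubgroup.mem_top k)

variable (p)

/-- The character `(b,e) ↦ b(x)` of `A`. -/
noncomputable def character (x : Plank) : p.algA →⋆ₙₐ[ℂ] ℂ where
  toFun a := a.1.1 x
  map_smul' _ _ := rfl
  map_zero' := rfl
  map_add' _ _ := rfl
  map_mul' _ _ := rfl
  map_star' _ := rfl

theorem exists_character_ne_zero (x : Plank) : ∃ a, p.character x a ≠ 0 := by
  obtain ⟨f, hfx, -⟩ := exists_zeroAtInfty_bump (𝕜 := ℂ) isOpen_univ (mem_univ x)
  exact ⟨p.ofB f, hfx.trans_ne one_ne_zero⟩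

/-- The representation `(b,e) ↦ e` of `A` on `H`. -/
noncomputable def sndRep : p.algA →⋆ₙₐ[ℂ] (H →L[ℂ] H) where
  toFun a := a.1.2.1
  map_smul' _ _ := rfl
  map_zero' := rfl
  map_add' _ _ := rfl
  map_mul' _ _ := rfl
  map_star' _ := rfl

theorem isIrreducibleRep_sndRep : IsIrreducibleRep (A := p.algA) p.sndRep where
  nonzero :=
    let ⟨v, hv⟩ := p.exists_ne_zero
    ⟨p.ofK (compactRankOne v v), InnerProductSpace.rankOne_ne_zero hv hv⟩
  irreducible _ _ hV := eq_bot_or_top_of_rankOne_mem fun x y => hV (p.ofK (compactRankOne x y))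

/-- The primitive ideal of `A` at a point of `X`: the kernel of the character at `x` for `x ∈ Y`,
and the kernel of the representation on `H` for the point `y`. -/
noncomputable def primOf : SpaceX → Prim p.algA
  | SpaceX.emb x =>
    ⟨_, isPrimitiveIdeal_ker_character (p.character x) (p.exists_character_ne_zero x)⟩
  | SpaceX.extra => ⟨_, isPrimitiveIdeal_ker p.isIrreducibleRep_sndRep⟩

variable {p}

theorem mem_primOf_emb {x : Plank} {a : p.algA} :
    a ∈ (p.primOf (SpaceX.emb x)).ideal ↔ a.1.1 x = 0 :=
  TwoSidedIdeal.mem_ker (p.character x)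

theorem mem_primOf_extra {a : p.algA} : a ∈ (p.primOf SpaceX.extra).ideal ↔ a.1.2 = 0 :=
  (TwoSidedIdeal.mem_ker p.sndRep).trans ZeroMemClass.coe_eq_zero

theorem ofK_mem_primOf_emb (x : Plank) (k : compactOperator (RingHom.id ℂ) H H) :
    p.ofK k ∈ (p.primOf (SpaceX.emb x)).ideal :=
  mem_primOf_emb.2 rfl

theorem isClosed_setOf_mem_primOf (a : p.algA) : IsClosed {x | a ∈ (p.primOf x).ideal} := by
  rw [← isOpen_compl_iff]
  refine ⟨?_, ?_⟩
  · simp only [preimage_compl, preimage_ofPred_eq, mem_primOf_emb]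
    exact isOpen_ne_fun (map_continuous a.1.1) continuous_const
  · rintro ⟨s, hs, hsa⟩ ha
    refine hsa (mem_primOf_emb.2 ?_)
    have hzero : restrictS a.1.1 = 0 := by rw [restrictS_fst, mem_primOf_extra.1 ha, map_zero]
    exact DFunLike.congr_fun hzero (⟨s, hs⟩ : plankS)

theorem exists_forall_mem_primOf_and_notMem {F : Set SpaceX} (hF : IsClosed F) {x : SpaceX}
    (hx : x ∉ F) : ∃ a, (∀ z ∈ F, a ∈ (p.primOf z).ideal) ∧ a ∉ (p.primOf x).ideal := by
  obtain ⟨hopen, hextra⟩ := SpaceX.isOpen_iff.1 hF.isOpen_compl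
  rcases x with x | _
  · obtain ⟨f, hfx, hf, -⟩ := exists_zeroAtInfty_bump (𝕜 := ℂ) hopen hx
    refine ⟨p.ofB f, ?_, fun h => one_ne_zero (hfx.symm.trans (mem_primOf_emb.1 h))⟩
    rintro (z | _) hz
    · exact mem_primOf_emb.2 (hf z fun h => h hz)
    · have hzero : restrictS f = 0 := by
        ext s
        exact hf s fun h => hextra ⟨s, s.2, h⟩ hz
      exact mem_primOf_extra.2 ((congrArg p.rhoE hzero).trans (map_zero p.rhoE))
  · obtain ⟨v, hv⟩ := p.exists_ne_zero
    refine ⟨p.ofK (compactRankOne v v), ?_, fun h => ?_⟩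
    · rintro (z | _) hz
      exacts [ofK_mem_primOf_emb z _, (hx hz).elim]
    · exact InnerProductSpace.rankOne_ne_zero hv hv (congrArg Subtype.val (mem_primOf_extra.1 h))

theorem mem_ideal_iff_ofB_fst_mem {P : Prim p.algA} (hK : ∀ k, p.ofK k ∈ P.ideal) (a : p.algA) :
    a ∈ P.ideal ↔ p.ofB a.1.1 ∈ P.ideal := by
  obtain ⟨k, hk⟩ := exists_eq_ofB_add_ofK a
  conv_lhs => rw [hk]
  exact ⟨fun h => by simpa using P.ideal.sub_mem h (hK k), fun h => P.ideal.add_mem h (hK k)⟩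

theorem ofB_mem_or_ofB_mem_of_mul_eq_zero {P : Prim p.algA} (hK : ∀ k, p.ofK k ∈ P.ideal)
    {f g : C₀(Plank, ℂ)} (hfg : f * g = 0) : p.ofB f ∈ P.ideal ∨ p.ofB g ∈ P.ideal := by
  refine P.2.prime (a := p.ofB f) (b := p.ofB g) fun c =>
    (mem_ideal_iff_ofB_fst_mem hK (p.ofB f * c * p.ofB g)).2 ?_
  have hzero : (p.ofB f * c * p.ofB g).1.1 = 0 := by
    change f * c.1.1 * g = 0
    rw [mul_right_comm, hfg, zero_mul]
  rw [hzero, map_zero p.ofB]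
  exact P.ideal.zero_mem

theorem exists_primOf_emb_eq {P : Prim p.algA} (hK : ∀ k, p.ofK k ∈ P.ideal) :
    ∃ x, p.primOf (SpaceX.emb x) = P := by
  have hmem (f : C₀(Plank, ℂ)) : f ∈ P.ideal.comap p.ofB ↔ p.ofB f ∈ P.ideal :=
    TwoSidedIdeal.mem_comap p.ofB
  have hclosed : IsClosed {f | f ∈ P.ideal.comap p.ofB} := by
    simpa only [hmem] using! P.2.isClosed.preimage (map_continuous p.ofB)
  have hproper : ∃ f, f ∉ P.ideal.comap p.ofB := by
    obtain ⟨a, ha⟩ := P.2.exists_notMem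
    exact ⟨a.1.1, fun h => ha ((mem_ideal_iff_ofB_fst_mem hK a).2 ((hmem _).1 h))⟩
  obtain ⟨x, hx⟩ := exists_forall_mem_iff_apply_eq_zero hclosed hproper fun f g hfg => by
    simpa only [hmem] using ofB_mem_or_ofB_mem_of_mul_eq_zero hK hfg
  exact ⟨x, Prim.ideal_injective <| SetLike.ext fun a => mem_primOf_emb.trans <|
    (hx _).symm.trans <| (hmem _).trans (mem_ideal_iff_ofB_fst_mem hK a).symm⟩

theorem compactRankOne_mul_mul (a : p.algA) (x y u v : H) :
    p.ofK (compactRankOne x u) * a * p.ofK (compactRankOne v y) =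
      p.ofK (compactRankOne (inner ℂ u ((a.1.2 : H →L[ℂ] H) v) • x) y) := by
  refine algA_ext ((congrArg (· * _) (zero_mul _)).trans (zero_mul _)) ?_
  ext z
  change inner ℂ u ((a.1.2 : H →L[ℂ] H) (inner ℂ y z • v)) • x =
    inner ℂ y z • inner ℂ u ((a.1.2 : H →L[ℂ] H) v) • x
  rw [map_smul, inner_smul_right, smul_smul]

theorem primOf_extra_eq {P : Prim p.algA} {k : compactOperator (RingHom.id ℂ) H H}
    (hk : p.ofK k ∉ P.ideal) : p.primOf SpaceX.extra = P := by
  refine Prim.ideal_injective <| SetLike.ext fun a => mem_primOf_extra.trans ⟨fun ha => ?_, ?_⟩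
  · refine (P.2.prime (a := a) (b := p.ofK k) fun c => ?_).resolve_right hk
    have hzero : a * c * p.ofK k = 0 := by
      refine algA_ext (mul_zero _) ?_
      change (a.1.2 : H →L[ℂ] H) * c.1.2 * k.1 = 0
      rw [ha, ZeroMemClass.coe_zero, zero_mul, zero_mul]
    exact hzero ▸ P.ideal.zero_mem
  · contrapose!
    intro ha hmem
    obtain ⟨v, hv⟩ : ∃ v, (a.1.2 : H →L[ℂ] H) v ≠ 0 := by
      by_contra! hzero
      exact ha (Subtype.ext (ContinuousLinearMap.ext hzero))
    refine hk (forall_ofK_mem_of_compactRankOne P.2.isClosed (fun x y => ?_) k)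
    have hinner : inner ℂ ((a.1.2 : H →L[ℂ] H) v) ((a.1.2 : H →L[ℂ] H) v) ≠ 0 :=
      inner_self_ne_zero.2 hv
    rw [← inv_smul_smul₀ hinner x, smul_comm, ← compactRankOne_mul_mul]
    exact P.ideal.mul_mem_right _ _ (P.ideal.mul_mem_left _ _ hmem)

theorem surjective_primOf : Function.Surjective p.primOf := by
  intro P
  by_cases hK : ∀ k, p.ofK k ∈ P.ideal
  · obtain ⟨x, hx⟩ := exists_primOf_emb_eq hK
    exact ⟨_, hx⟩
  · obtain ⟨k, hk⟩ := not_forall.1 hK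
    exact ⟨_, primOf_extra_eq hk⟩

variable (p)

/-- The identification `φ` of `X` with `Prim(A)`. -/
noncomputable def primHomeomorph : SpaceX ≃ₜ Prim p.algA :=
  (Prim.isInducing_of_separating isClosed_setOf_mem_primOf fun _ hF _ hx =>
    exists_forall_mem_primOf_and_notMem hF hx).isEmbedding.toHomeomorphOfSurjective
      surjective_primOf

variable {p}

theorem quotientNorm_glimmMap_le (a : p.algA) {t : Plank} (ht : t ∉ plankS) :
    quotientNorm a (glimmMap (p.primHomeomorph (SpaceX.emb t))).ideal ≤ ‖a.1.1 t‖ := by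
  obtain ⟨f, hft, -, hf⟩ := exists_zeroAtInfty_bump (𝕜 := ℂ) isOpen_univ (mem_univ t)
  have hcollapse : SpaceX.collapse (SpaceX.emb t) = SpaceX.emb t :=
    if_neg fun h => ht (by simpa using SpaceX.extra_specializes_iff.1 h)
  have hmem : p.ofB (a.1.1 t • f) - a ∈ glimmIdeal (p.primHomeomorph (SpaceX.emb t)) := by
    rw [glimmIdeal_homeomorph, hcollapse]
    refine mem_primOf_emb.2 ?_
    change a.1.1 t * f t - a.1.1 t = 0
    rw [hft, mul_one, sub_self]
  calc quotientNorm a _ ≤ ‖p.ofB (a.1.1 t • f)‖ := quotientNorm_le_of_sub_mem hmem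
    _ ≤ ‖a.1.1 t • f‖ := NonUnitalStarAlgHom.norm_apply_le p.ofB _
    _ ≤ ‖a.1.1 t‖ := (norm_zeroAtInfty_le (norm_nonneg _)).2 fun x =>
      (norm_mul _ _).trans_le <| mul_le_of_le_one_right (norm_nonneg _) <|
        (norm_zeroAtInfty_le zero_le_one).1 hf x

theorem not_setK_subset_le_quotientNorm (a : p.algA) {α : ℝ} (hα : 0 < α) :
    ¬ p.setK p.primHomeomorph ⊆ {G | α ≤ quotientNorm a G.ideal} := by
  intro hsub
  refine not_isCompact_plankT <|
    (isCompact_setOf_le_norm a.1.1 hα).of_isClosed_subset isClosed_plankT fun t ht => ?_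
  exact (show α ≤ _ from hsub ⟨_, Or.inl ⟨t, ht, rfl⟩, rfl⟩).trans
    (quotientNorm_glimmMap_le a (fst_ne_top_of_mem_plankT ht))

end ProjSeq

end GlimmSpace

theorem mainTheorem5_general {H : Type*} [NormedAddCommGroup H] [InnerProductSpace ℂ H]
    [CompleteSpace H] (hH : ¬ FiniteDimensional ℂ H) :
    Nonempty (GlimmSpace.ProjSeq H) ∧
    LocallyCompactSpace GlimmSpace.SpaceX ∧ T0Space GlimmSpace.SpaceX ∧
    ∀ p : GlimmSpace.ProjSeq H, ∃ φ : GlimmSpace.SpaceX ≃ₜ GlimmSpace.Prim p.algA,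
      (∀ (x : GlimmSpace.Plank) (a : p.algA),
        a ∈ (φ (GlimmSpace.SpaceX.emb x)).ideal ↔ a.1.1 x = 0) ∧
      (∀ a : p.algA, a ∈ (φ GlimmSpace.SpaceX.extra).ideal ↔ a.1.2 = 0) ∧
      (∀ x x' : GlimmSpace.SpaceX,
        GlimmSpace.glimmMap (φ x) = GlimmSpace.glimmMap (φ x') ↔
          x = x' ∨
            (x ∈ GlimmSpace.SpaceX.emb '' GlimmSpace.plankS ∪ {GlimmSpace.SpaceX.extra} ∧
              x' ∈ GlimmSpace.SpaceX.emb '' GlimmSpace.plankS ∪ {GlimmSpace.SpaceX.extra})) ∧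
      @IsCompact _ (GlimmSpace.tauCR p.algA) (p.setK φ) ∧
      ¬ @IsCompact _ (GlimmSpace.tauQ p.algA) (p.setK φ) ∧
      ∀ (a : p.algA) (α : ℝ), 0 < α →
        ¬ p.setK φ ⊆ {G | α ≤ GlimmSpace.quotientNorm a G.ideal} := by
  refine ⟨GlimmSpace.nonempty_projSeq hH, inferInstance, inferInstance, fun p => ?_⟩
  refine ⟨p.primHomeomorph, fun _ _ => GlimmSpace.ProjSeq.mem_primOf_emb,
    fun _ => GlimmSpace.ProjSeq.mem_primOf_extra, fun x x' => ?_,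
    GlimmSpace.isCompact_tauCR_image_edge _, GlimmSpace.not_isCompact_tauQ_image_edge _,
    fun a _ hα => GlimmSpace.ProjSeq.not_setK_subset_le_quotientNorm a hα⟩
  rw [GlimmSpace.glimmMap_homeomorph_eq_iff, GlimmSpace.SpaceX.collapse_eq_collapse_iff]

theorem mainTheorem5 {H : Type*} [NormedAddCommGroup H] [InnerProductSpace ℂ H] [CompleteSpace H]
    [TopologicalSpace.SeparableSpace H] (hH : ¬ FiniteDimensional ℂ H) :
    Nonempty (GlimmSpace.ProjSeq H) ∧
    LocallyCompactSpace GlimmSpace.SpaceX ∧ T0Space GlimmSpace.SpaceX ∧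
    ∀ p : GlimmSpace.ProjSeq H, ∃ φ : GlimmSpace.SpaceX ≃ₜ GlimmSpace.Prim p.algA,
      -- the identification of `X` with `Prim(A)`
      (∀ (x : GlimmSpace.Plank) (a : p.algA),
        a ∈ (φ (GlimmSpace.SpaceX.emb x)).ideal ↔ a.1.1 x = 0) ∧
      (∀ a : p.algA, a ∈ (φ GlimmSpace.SpaceX.extra).ideal ↔ a.1.2 = 0) ∧
      -- `S ∪ {y}` is one equivalence class, and all the other classes are single points
      (∀ x x' : GlimmSpace.SpaceX,
        GlimmSpace.glimmMap (φ x) = GlimmSpace.glimmMap (φ x') ↔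
          x = x' ∨
            (x ∈ GlimmSpace.SpaceX.emb '' GlimmSpace.plankS ∪ {GlimmSpace.SpaceX.extra} ∧
              x' ∈ GlimmSpace.SpaceX.emb '' GlimmSpace.plankS ∪ {GlimmSpace.SpaceX.extra})) ∧
      -- `K` is compact for `τ_cr` but not for `τ_q`, and no norm inequality covers it
      @IsCompact _ (GlimmSpace.tauCR p.algA) (p.setK φ) ∧
      ¬ @IsCompact _ (GlimmSpace.tauQ p.algA) (p.setK φ) ∧
      ∀ (a : p.algA) (α : ℝ), 0 < α →
        ¬ p.setK φ ⊆ {G | α ≤ GlimmSpace.quotientNorm a G.ideal} :=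
  mainTheorem5_general hH
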